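/- For integers $m\ge 1$ and $n,k\ge 0$ let ${n\brace k}_{\ge m}$ be the associated Stirling number of the second kind, i.e. the number of partitions of an $n$-element set into $k$ nonempty blocks, each containing at least $m$ elements. For $\mu\in\mathbb C$ define the associated poly-Bernoulli numbers by $$B_{n,\ge m}^{(\mu)}=\sum_{k=0}^n(-1)^{n-k}\frac{k!}{(k+1)^\mu}{n\brace k}_{\ge m}\qquad(n\ge 0).$$ For $k\in\mathbb Z$ let $W_k$ be the $k$-th branch of the Lambert $W$ function (with the standard branch cuts), so that $W_k(a)e^{W_k(a)}=a$; in particular $W_0(-1)=\overline{W_{-1}(-1)}\approx -0.318132+1.337236\,i$. Theorem. For every $\mu\in\mathbb C$ with $\Re(\mu)>1$ and for $k=0$ and $k=-1$, the series below converges (absolutely) and $$\zeta(\mu)=\sum_{n=0}^\infty B_{n,\ge 2}^{(\mu)}\,\frac{(W_k(-1))^n}{n!},$$ where $\zeta$ is the Riemann zeta function. -/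

import Mathlib

noncomputable section

/-- The associated Stirling number of the second kind `{n, k}_{≥ m}`: the number of partitions of
an `n`-element set into `k` (nonempty) blocks, each of which has at least `m` elements. -/
def associatedStirlingSecond (m n k : ℕ) : ℕ :=
  (Finset.univ.filter fun P : Finpartition (Finset.univ : Finset (Fin n)) =>
    P.parts.card = k ∧ ∀ b ∈ P.parts, m ≤ b.card).card

/-- The associated poly-Bernoulli number
`B_{n, ≥ m}^{(μ)} = ∑_{k=0}^n (-1)^{n-k} k! / (k+1)^μ {n, k}_{≥ m}`, for complex `μ`. -/
def associatedPolyBernoulli (m : ℕ) (μ : ℂ) (n : ℕ) : ℂ :=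
  ∑ k ∈ Finset.range (n + 1),
    (-1 : ℂ) ^ (n - k) * ((k.factorial : ℂ) / ((k : ℂ) + 1) ^ μ) *
      (associatedStirlingSecond m n k : ℂ)

/-- The range of the `k`-th branch of the Lambert `W` function, with the standard branch cuts:
the points `w` with `(2k-1)π < Im w + arg w ≤ (2k+1)π` (that is, `w + Log w = Log (w e^w) + 2πik`
when `w ≠ 0`), except that the real half-line `(-∞, -1)` is moved from the principal branch to the
branch `-1`, whose range also contains the branch point value `-1`. -/
def lambertWRange (k : ℤ) : Set ℂ :=
  {w | ((2 * (k : ℝ) - 1) * Real.pi < w.im + w.arg ∧ w.im + w.arg ≤ (2 * (k : ℝ) + 1) * Real.pi ∧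
        ¬ (w.im = 0 ∧ w.re < -1)) ∨
       (k = -1 ∧ w.im = 0 ∧ w.re ≤ -1)}

open Classical in
/-- The `k`-th branch `W_k` of the Lambert `W` function: `W_k(z)` is the solution `w` of
`w e^w = z` in the range of the branch. (It exists and is unique, except for `z = 0`, `k ≠ 0`,
where there is none and the value is set to `0`.) -/
def lambertW (k : ℤ) (z : ℂ) : ℂ :=
  if h : ∃ w : ℂ, w ∈ lambertWRange k ∧ w * Complex.exp w = z then h.choose else 0

end

open PowerSeries

/-! Put `h(x) = x + e^(-x)` and `G = 1 - h`, a power series without constant term. The exponential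
generating function of the associated Stirling numbers turns `B_n / n!` into `∑ (k+1)^(-μ) [x^n]
G^k`. Writing `Γ(μ) (k+1)^(-μ)` as the Mellin integral of `e^(-(k+1)t)` and summing the geometric
series gives `Γ(μ) B_n / n! = ∫ t^(μ-1) [x^n] Φ_t dt` over `t > 0`, with `Φ_t = 1 / (e^t - G) = 1 /
(e^t - 1 + h)`. A solution `w` of `w e^w = -1` is a zero of `h`, so `Φ_t(w) = 1 / (e^t - 1)`, whose
Mellin transform is `Γ(μ) ζ(μ)`.

The difficulty is exchanging sum and integral, because `w` lies on the circle that the poles of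
`Φ_t` approach as `t → 0`. It suffices that `∑ |[x^n] Φ_t| |w|^n ≤ K / (e^t - 1)`, which is
integrable against `t^(Re μ - 1)` exactly when `Re μ > 1`. This is `exists_wienerBound_resolvent`.
It rests on two facts about `s + h` for real `s ≥ 0`: its only zeros in the closed disc of radius
`|w|` are `w` and its conjugate, at `s = 0` (`zero_of_add_exp_neg`), and these two simple zeros
leave the disc with positive radial speed as `s` grows (`re_neg_inv_deriv_mul_conj_pos`). -/

/-! ### The weighted Wiener algebra of power series -/

/-- The `M`-th partial sum of the series `∑ ‖f_n‖ r ^ n` of a power series `f`. -/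
noncomputable def wienerSum (r : ℝ) (M : ℕ) (f : ℂ⟦X⟧) : ℝ :=
  ∑ n ∈ Finset.range M, ‖coeff n f‖ * r ^ n

/-- The weighted Wiener norm `∑ ‖f_n‖ r ^ n` of the power series `f` is at most `A`. -/
def WienerBound (r : ℝ) (f : ℂ⟦X⟧) (A : ℝ) : Prop :=
  ∀ M, wienerSum r M f ≤ A

lemma wienerSum_nonneg {r : ℝ} (hr : 0 ≤ r) (M : ℕ) (f : ℂ⟦X⟧) : 0 ≤ wienerSum r M f :=
  Finset.sum_nonneg fun _ _ => by positivity

lemma wienerSum_add_le {r : ℝ} (hr : 0 ≤ r) (M : ℕ) (f g : ℂ⟦X⟧) :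
    wienerSum r M (f + g) ≤ wienerSum r M f + wienerSum r M g := by
  unfold wienerSum
  rw [← Finset.sum_add_distrib]
  refine Finset.sum_le_sum fun n _ => ?_
  rw [← add_mul, map_add]
  gcongr
  exact norm_add_le _ _

/-- The index pairs with sum below `M` lie in the square of side `M`. Submultiplicativity thus holds
already for truncated sums, so convergence never has to be assumed. -/
lemma wienerSum_mul_le {r : ℝ} (hr : 0 ≤ r) (M : ℕ) (f g : ℂ⟦X⟧) :
    wienerSum r M (f * g) ≤ wienerSum r M f * wienerSum r M g := by
  unfold wienerSum
  calc ∑ n ∈ Finset.range M, ‖coeff n (f * g)‖ * r ^ n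
      ≤ ∑ n ∈ Finset.range M, ∑ p ∈ Finset.HasAntidiagonal.antidiagonal n,
          (‖coeff p.1 f‖ * r ^ p.1) * (‖coeff p.2 g‖ * r ^ p.2) := by
        refine Finset.sum_le_sum fun n _ => ?_
        rw [coeff_mul]
        refine (mul_le_mul_of_nonneg_right (norm_sum_le _ _) (by positivity)).trans_eq ?_
        rw [Finset.sum_mul]
        refine Finset.sum_congr rfl fun p hp => ?_
        rw [norm_mul, ← Finset.HasAntidiagonal.mem_antidiagonal.1 hp, pow_add]
        ring
    _ = ∑ p ∈ (Finset.range M).biUnion fun n => Finset.HasAntidiagonal.antidiagonal n,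
          (‖coeff p.1 f‖ * r ^ p.1) * (‖coeff p.2 g‖ * r ^ p.2) := by
        rw [Finset.sum_biUnion]
        intro a _ b _ hab
        refine Finset.disjoint_left.2 fun p hp hp' => hab ?_
        rw [← Finset.HasAntidiagonal.mem_antidiagonal.1 hp,
          ← Finset.HasAntidiagonal.mem_antidiagonal.1 hp']
    _ ≤ ∑ p ∈ Finset.range M ×ˢ Finset.range M,
          (‖coeff p.1 f‖ * r ^ p.1) * (‖coeff p.2 g‖ * r ^ p.2) := by
        refine Finset.sum_le_sum_of_subset_of_nonneg ?_ fun _ _ _ => by positivity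
        intro p hp
        simp only [Finset.mem_biUnion, Finset.mem_range, Finset.HasAntidiagonal.mem_antidiagonal,
          Finset.mem_product] at hp ⊢
        omega
    _ = _ := by rw [Finset.sum_mul_sum, Finset.sum_product]

namespace WienerBound

variable {r A B : ℝ} {f g : ℂ⟦X⟧}

lemma nonneg (hf : WienerBound r f A) : 0 ≤ A := by simpa [wienerSum] using hf 0

lemma mono (hf : WienerBound r f A) (h : A ≤ B) : WienerBound r f B := fun M => (hf M).trans h

lemma add (hr : 0 ≤ r) (hf : WienerBound r f A) (hg : WienerBound r g B) :
    WienerBound r (f + g) (A + B) :=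
  fun M => (wienerSum_add_le hr M f g).trans (add_le_add (hf M) (hg M))

lemma mul (hr : 0 ≤ r) (hf : WienerBound r f A) (hg : WienerBound r g B) :
    WienerBound r (f * g) (A * B) :=
  fun M => (wienerSum_mul_le hr M f g).trans
    (mul_le_mul (hf M) (hg M) (wienerSum_nonneg hr M g) hf.nonneg)

lemma neg (hf : WienerBound r f A) : WienerBound r (-f) A := fun M => by
  simpa [wienerSum] using hf M

lemma sub (hr : 0 ≤ r) (hf : WienerBound r f A) (hg : WienerBound r g B) :
    WienerBound r (f - g) (A + B) := sub_eq_add_neg f g ▸ hf.add hr hg.neg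

lemma const (r : ℝ) (c : ℂ) : WienerBound r (C c) ‖c‖ := fun M => by
  unfold wienerSum
  rcases M with _ | M
  · simp
  · rw [Finset.sum_range_succ']
    simp [coeff_C]

lemma one (r : ℝ) : WienerBound r 1 1 := by simpa using WienerBound.const r 1

lemma X (hr : 0 ≤ r) : WienerBound r (X : ℂ⟦X⟧) r := fun M => by
  unfold wienerSum
  simp only [coeff_X]
  rw [Finset.sum_congr rfl (g := fun n => if n = 1 then r else 0)
    (fun n _ => by split_ifs with h <;> simp [h])]
  rw [Finset.sum_ite_eq']
  split_ifs <;> simp [hr]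

lemma const_mul (hr : 0 ≤ r) (c : ℂ) (hf : WienerBound r f A) :
    WienerBound r (C c * f) (‖c‖ * A) := (const r c).mul hr hf

/-- Neumann series: the inverse of a power series `1 - u` with `u` of norm at most `q < 1`. -/
lemma neumann (hr : 0 ≤ r) {u v : ℂ⟦X⟧} {q : ℝ} (hu : WienerBound r u q) (hq : q < 1)
    (huv : (1 - u) * v = 1) : WienerBound r v (1 / (1 - q)) := fun M => by
  have h1 : v = 1 + u * v := by linear_combination huv
  -- Partial sums are finite, so the term `q * wienerSum r M v` can be absorbed on the left without
  -- knowing beforehand that `v` has finite norm.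
  have h2 : wienerSum r M v ≤ 1 + q * wienerSum r M v := by
    conv_lhs => rw [h1]
    refine (wienerSum_add_le hr M _ _).trans (add_le_add (one r M) ?_)
    exact (wienerSum_mul_le hr M _ _).trans
      (mul_le_mul_of_nonneg_right (hu M) (wienerSum_nonneg hr M v))
  rw [le_div_iff₀ (by linarith)]
  linarith

lemma summable_norm (hf : WienerBound r f A) {x : ℂ} (hx : ‖x‖ ≤ r) :
    Summable fun n => ‖coeff n f * x ^ n‖ := by
  refine summable_of_sum_range_le (c := A) (fun _ => norm_nonneg _) fun M => ?_
  refine (Finset.sum_le_sum fun n _ => ?_).trans (hf M)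
  rw [norm_mul, norm_pow]
  gcongr

lemma tsum_mul (hf : WienerBound r f A) (hg : WienerBound r g B) {x : ℂ}
    (hx : ‖x‖ ≤ r) :
    ∑' n, coeff n (f * g) * x ^ n = (∑' n, coeff n f * x ^ n) * ∑' n, coeff n g * x ^ n := by
  rw [tsum_mul_tsum_eq_tsum_sum_antidiagonal_of_summable_norm (hf.summable_norm hx)
    (hg.summable_norm hx)]
  refine tsum_congr fun n => ?_
  rw [coeff_mul, Finset.sum_mul]
  refine Finset.sum_congr rfl fun p hp => ?_
  rw [← Finset.HasAntidiagonal.mem_antidiagonal.1 hp, pow_add]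
  ring

end WienerBound

/-! ### Taylor series of holomorphic functions -/

/-- The Taylor series at `0` of a complex function. -/
noncomputable def taylorPS (f : ℂ → ℂ) : ℂ⟦X⟧ := mk fun n => iteratedDeriv n f 0 / (n.factorial : ℂ)

lemma taylorPS_congr {f g : ℂ → ℂ} (h : f =ᶠ[nhds 0] g) : taylorPS f = taylorPS g := by
  ext n
  simp [taylorPS, h.iteratedDeriv_eq n]

lemma taylorPS_add {f g : ℂ → ℂ} (hf : AnalyticAt ℂ f 0) (hg : AnalyticAt ℂ g 0) :
    taylorPS (fun x => f x + g x) = taylorPS f + taylorPS g := by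
  ext n
  simp only [taylorPS, coeff_mk, map_add]
  rw [iteratedDeriv_fun_add hf.contDiffAt hg.contDiffAt, add_div]

lemma taylorPS_mul {f g : ℂ → ℂ} (hf : AnalyticAt ℂ f 0) (hg : AnalyticAt ℂ g 0) :
    taylorPS (fun x => f x * g x) = taylorPS f * taylorPS g := by
  ext n
  simp only [taylorPS, coeff_mk, coeff_mul]
  rw [iteratedDeriv_fun_mul hf.contDiffAt hg.contDiffAt,
    Finset.Nat.sum_antidiagonal_eq_sum_range_succ_mk, Finset.sum_div]
  refine Finset.sum_congr rfl fun i hi => ?_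
  rw [Nat.cast_choose ℂ (Finset.mem_range_succ_iff.1 hi)]
  have := (n.factorial_ne_zero)
  field_simp

lemma taylorPS_const (c : ℂ) : taylorPS (fun _ => c) = C c := by
  ext n
  simp only [taylorPS, coeff_mk, iteratedDeriv_const, coeff_C]
  split_ifs with h <;> simp [h]

lemma taylorPS_id : taylorPS (fun x => x) = X := by
  ext n
  have : (fun x : ℂ => x) = id := rfl
  simp only [taylorPS, coeff_mk, coeff_X, this, iteratedDeriv_id]
  split_ifs with h h' <;> simp_all

lemma exists_wienerBound_taylorPS {f : ℂ → ℂ} {r R : ℝ} (hr : 0 ≤ r) (hrR : r < R)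
    (hf : DifferentiableOn ℂ f (Metric.ball 0 R)) : ∃ A, WienerBound r (taylorPS f) A := by
  have h := (Complex.hasSum_taylorSeries_on_ball hf (z := (r : ℂ))
    (by simpa [abs_of_nonneg hr] using hrR)).summable.norm
  have h' : Summable fun n => ‖coeff n (taylorPS f)‖ * r ^ n := by
    refine h.congr fun n => ?_
    simp [taylorPS, abs_of_nonneg hr]
    ring
  exact ⟨_, fun M => h'.sum_le_tsum (Finset.range M) fun _ _ => by positivity⟩

lemma tsum_taylorPS {f : ℂ → ℂ} {R : ℝ} (hf : DifferentiableOn ℂ f (Metric.ball 0 R)) {x : ℂ}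
    (hx : ‖x‖ < R) : ∑' n, coeff n (taylorPS f) * x ^ n = f x := by
  have h := Complex.hasSum_taylorSeries_on_ball hf (z := x) (by simpa using hx)
  rw [← h.tsum_eq]
  refine tsum_congr fun n => ?_
  simp [taylorPS]
  ring

/-! ### Inverses and resolvent estimates in the Wiener norm -/

lemma WienerBound.exists_inv_one_sub {r q : ℝ} (hr : 0 ≤ r) {u : ℂ⟦X⟧} (hu : WienerBound r u q)
    (hq : q < 1) : ∃ v, (1 - u) * v = 1 ∧ WienerBound r v (1 / (1 - q)) := by
  have h0 : constantCoeff (1 - u) ≠ 0 := by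
    intro h
    have h1 := hu 1
    have h2 : constantCoeff u = 1 := by
      rw [map_sub, map_one] at h
      linear_combination -h
    simp [wienerSum, h2] at h1
    linarith
  have h1 := PowerSeries.mul_inv_cancel _ h0
  exact ⟨_, h1, hu.neumann hr hq h1⟩

lemma exists_inv_X_sub_C {r : ℝ} (hr : 0 ≤ r) {ρ : ℂ} (hρ : r < ‖ρ‖) :
    ∃ g : ℂ⟦X⟧, (X - C ρ) * g = 1 ∧ WienerBound r g (1 / (‖ρ‖ - r)) := by
  have h0 : 0 < ‖ρ‖ := hr.trans_lt hρ
  have hu : WienerBound r (C ρ⁻¹ * X) (‖ρ⁻¹‖ * r) := (WienerBound.X hr).const_mul hr _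
  have hq : ‖ρ⁻¹‖ * r < 1 := by
    rw [norm_inv, inv_mul_lt_one₀ h0]
    exact hρ
  obtain ⟨v, hv, hvb⟩ := hu.exists_inv_one_sub hr hq
  have hC : (C ρ : ℂ⟦X⟧) * C ρ⁻¹ = 1 := by
    rw [← map_mul, mul_inv_cancel₀ (norm_pos_iff.1 h0), map_one]
  refine ⟨-(C ρ⁻¹ * v), ?_, ((hvb.const_mul hr ρ⁻¹).neg).mono (le_of_eq ?_)⟩
  · linear_combination hv + v * hC
  · rw [norm_inv] at hq ⊢
    have h1 : ‖ρ‖ - r ≠ 0 := by linarith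
    have h2 : 1 - ‖ρ‖⁻¹ * r ≠ 0 := by linarith
    have h3 : ‖ρ‖ * (1 - ‖ρ‖⁻¹ * r) = ‖ρ‖ - r := by field_simp
    rw [← h3]
    field_simp

/-- Partial fractions: the bound involves the sum, not the product, of the two inverse distances to
the circle. This keeps the blow-up at order `1 / s` when both roots are at distance of order `s`. -/
lemma exists_inv_X_sub_C_mul_X_sub_C {r : ℝ} (hr : 0 ≤ r) {ρ₁ ρ₂ : ℂ} (h₁ : r < ‖ρ₁‖)
    (h₂ : r < ‖ρ₂‖) (h : ρ₁ ≠ ρ₂) :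
    ∃ E : ℂ⟦X⟧, (X - C ρ₁) * (X - C ρ₂) * E = 1 ∧
      WienerBound r E (‖(ρ₁ - ρ₂)⁻¹‖ * (1 / (‖ρ₁‖ - r) + 1 / (‖ρ₂‖ - r))) := by
  obtain ⟨g₁, hg₁, hb₁⟩ := exists_inv_X_sub_C hr h₁
  obtain ⟨g₂, hg₂, hb₂⟩ := exists_inv_X_sub_C hr h₂
  refine ⟨C (ρ₁ - ρ₂)⁻¹ * (g₁ - g₂), ?_, (hb₁.sub hr hb₂).const_mul hr _⟩
  have hC : ((C ρ₁ : ℂ⟦X⟧) - C ρ₂) * C (ρ₁ - ρ₂)⁻¹ = 1 := by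
    rw [← map_sub, ← map_mul, mul_inv_cancel₀ (sub_ne_zero.2 h), map_one]
  linear_combination C (ρ₁ - ρ₂)⁻¹ * (X - C ρ₂) * hg₁ - C (ρ₁ - ρ₂)⁻¹ * (X - C ρ₁) * hg₂ + hC

/-- Project `w + s a` onto the direction of `w`: a positive radial component of `a` moves the point
outside the circle at linear rate. -/
lemma norm_add_mul_ge {r s : ℝ} (hr : 0 < r) {w a : ℂ} (hw : ‖w‖ = r) :
    r + s * ((a * (starRingEnd ℂ) w).re / r) ≤ ‖w + s * a‖ := by
  have h1 : ((w + s * a) * (starRingEnd ℂ) w).re ≤ ‖w + s * a‖ * r := by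
    refine (Complex.re_le_norm _).trans_eq ?_
    rw [norm_mul, Complex.norm_conj, hw]
  have h2 : ((w + s * a) * (starRingEnd ℂ) w).re = r ^ 2 + s * (a * (starRingEnd ℂ) w).re := by
    rw [add_mul, Complex.mul_conj, Complex.normSq_eq_norm_sq, hw, mul_assoc, Complex.add_re,
      Complex.re_ofReal_mul, Complex.ofReal_re]
  have h3 : r + s * ((a * (starRingEnd ℂ) w).re / r)
      = (r ^ 2 + s * (a * (starRingEnd ℂ) w).re) / r := by
    field_simp
  rw [h3, div_le_iff₀ hr]
  linarith

/-- The resolvent estimate near `s = 0`, when the zeros `w₁`, `w₂` of `H` of smallest modulus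
move outwards as zeros of `s + H`. -/
lemma exists_wienerBound_resolvent_small {r : ℝ} (hr : 0 < r) {H P Q : ℂ⟦X⟧} {w₁ w₂ a₁ a₂ : ℂ}
    {A B : ℝ} (hw₁ : ‖w₁‖ = r) (hw₂ : ‖w₂‖ = r) (hw : w₁ ≠ w₂)
    (ha₁ : 0 < (a₁ * (starRingEnd ℂ) w₁).re) (ha₂ : 0 < (a₂ * (starRingEnd ℂ) w₂).re)
    (hHP : H * P = (X - C w₁) * (X - C w₂))
    (hP : P = -(C a₁ * (X - C w₂)) - C a₂ * (X - C w₁) + (X - C w₁) * (X - C w₂) * Q)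
    (hPA : WienerBound r P A) (hQB : WienerBound r Q B) :
    ∃ ε > 0, ∃ K : ℝ, ∀ s : ℝ, 0 < s → s ≤ ε → ∀ Φ : ℂ⟦X⟧, (C (s : ℂ) + H) * Φ = 1 →
      WienerBound r Φ (K / s) := by
  obtain ⟨c, hc, hc₁, hc₂⟩ : ∃ c > 0, c ≤ (a₁ * (starRingEnd ℂ) w₁).re / r ∧
      c ≤ (a₂ * (starRingEnd ℂ) w₂).re / r :=
    ⟨_, lt_min (div_pos ha₁ hr) (div_pos ha₂ hr), min_le_left _ _, min_le_right _ _⟩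
  set δ := ‖w₁ - w₂‖ with hδ
  have hδ0 : 0 < δ := norm_pos_iff.2 (sub_ne_zero.2 hw)
  set K₀ := 4 / (c * δ) with hK₀
  have hK₀0 : 0 < K₀ := by positivity
  -- `L` is the linear interpolant of `P` at `w₁` and `w₂`. It is also the first-order change of `(X
  -- - w₁)(X - w₂)` when the roots move with velocities `a₁` and `a₂`.
  set L := -(C a₁ * (X - C w₂)) - C a₂ * (X - C w₁) with hL
  obtain ⟨N, hN⟩ : ∃ N, WienerBound r L N :=
    ⟨_, ((((WienerBound.X hr.le).sub hr.le (.const r w₂)).const_mul hr.le a₁).neg).sub hr.le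
      (((WienerBound.X hr.le).sub hr.le (.const r w₁)).const_mul hr.le a₂)⟩
  have hN0 := hN.nonneg
  have hA0 := hPA.nonneg
  have hB0 := hQB.nonneg
  set U := ‖a₁ * a₂‖ * K₀ + B * (1 + N * K₀ + ‖a₁ * a₂‖ * K₀) with hU
  have hU0 : 0 ≤ U := by positivity
  refine ⟨min 1 (min (δ / (2 * (‖a₁ - a₂‖ + 1))) (1 / (2 * (U + 1)))), by positivity,
    2 * K₀ * A, fun s hs hsε Φ hΦ => ?_⟩
  have hs1 : s ≤ 1 := hsε.trans (min_le_left _ _)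
  have hsδ : s * ‖a₁ - a₂‖ ≤ δ / 2 := by
    have h := hsε.trans ((min_le_right _ _).trans (min_le_left _ _))
    rw [le_div_iff₀ (by positivity)] at h
    nlinarith [norm_nonneg (a₁ - a₂)]
  have hsU : s * U ≤ 1 / 2 := by
    have h := hsε.trans ((min_le_right _ _).trans (min_le_right _ _))
    rw [le_div_iff₀ (by positivity)] at h
    nlinarith
  have hρ₁ : r + s * c ≤ ‖w₁ + s * a₁‖ := le_trans (by gcongr) (norm_add_mul_ge hr hw₁)
  have hρ₂ : r + s * c ≤ ‖w₂ + s * a₂‖ := le_trans (by gcongr) (norm_add_mul_ge hr hw₂)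
  have hsc : 0 < s * c := by positivity
  have hρ : δ / 2 ≤ ‖(w₁ + s * a₁) - (w₂ + s * a₂)‖ := by
    have h1 : w₁ - w₂ = ((w₁ + s * a₁) - (w₂ + s * a₂)) - s * (a₁ - a₂) := by ring
    have h2 : δ ≤ ‖(w₁ + s * a₁) - (w₂ + s * a₂)‖ + s * ‖a₁ - a₂‖ := by
      rw [hδ, h1]
      refine (norm_sub_le _ _).trans_eq ?_
      rw [norm_mul, Complex.norm_real, Real.norm_of_nonneg hs.le]
    linarith
  have hne : w₁ + s * a₁ ≠ w₂ + s * a₂ := by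
    rw [← sub_ne_zero, ← norm_pos_iff]
    linarith
  obtain ⟨E, hE, hEb'⟩ := exists_inv_X_sub_C_mul_X_sub_C hr.le (by linarith : r < ‖w₁ + s * a₁‖)
    (by linarith : r < ‖w₂ + s * a₂‖) hne
  have hEb : WienerBound r E (K₀ / s) := by
    refine hEb'.mono ?_
    calc _ ≤ (δ / 2)⁻¹ * (1 / (s * c) + 1 / (s * c)) := by
          rw [norm_inv]
          have h₁ : 0 ≤ 1 / (‖w₁ + s * a₁‖ - r) := one_div_nonneg.2 (by linarith)
          have h₂ : 0 ≤ 1 / (‖w₂ + s * a₂‖ - r) := one_div_nonneg.2 (by linarith)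
          gcongr <;> linarith
      _ = K₀ / s := by
          rw [hK₀]
          field_simp
          ring
  simp only [map_add, map_mul] at hE
  set σ : ℂ⟦X⟧ := C (s : ℂ) with hσ
  have hσb : WienerBound r σ s := by
    simpa [abs_of_pos hs] using WienerBound.const r (s : ℂ)
  have hab : WienerBound r (C a₁ * C a₂) ‖a₁ * a₂‖ := by
    rw [← map_mul]
    exact .const r _
  have hu := ((hσb.mul hr.le ((hσb.mul hr.le hEb).mul hr.le hab))).sub hr.le
    ((hσb.mul hr.le hQB).mul hr.le (((WienerBound.one r).sub hr.le
      ((hσb.mul hr.le hEb).mul hr.le hN)).sub hr.le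
      (hσb.mul hr.le ((hσb.mul hr.le hEb).mul hr.le hab))))
  -- `E * P` is an approximate inverse of `σ + H`, with error `u`. Although `E` has size `1 / s`,
  -- each `E` in `u` is paired with a factor `σ`, and one more `σ` remains, so `u = O(s)`.
  set u := σ * (σ * E * (C a₁ * C a₂)) -
    σ * Q * (1 - σ * E * L - σ * (σ * E * (C a₁ * C a₂))) with hudef
  have hq : WienerBound r u (1 / 2) := by
    refine hu.mono (le_trans ?_ hsU)
    have h1 : s * (K₀ / s) = K₀ := by field_simp
    rw [h1, hU]
    have h2 : s * (K₀ * ‖a₁ * a₂‖) ≤ K₀ * ‖a₁ * a₂‖ := mul_le_of_le_one_left (by positivity) hs1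
    have h3 : s * B * (1 + K₀ * N + s * (K₀ * ‖a₁ * a₂‖))
        ≤ s * B * (1 + K₀ * N + K₀ * ‖a₁ * a₂‖) := by gcongr
    linarith
  obtain ⟨v, hv, hvb⟩ := hq.exists_inv_one_sub hr.le (by norm_num)
  have hkey : E * (σ + H) * P = 1 - u := by
    -- The quadratic with moved roots `w_i + s a_i` equals the original one plus `σ L`, up to the
    -- exact second-order term.
    have h1 : (X - C w₁) * (X - C w₂) + σ * L + σ * σ * (C a₁ * C a₂)
        = (X - (C w₁ + σ * C a₁)) * (X - (C w₂ + σ * C a₂)) := by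
      rw [hL]
      ring
    have h2 : (X - C w₁) * (X - C w₂) * E = 1 - σ * L * E - σ * σ * (C a₁ * C a₂) * E := by
      linear_combination hE + E * h1
    have h3 : E * (σ + H) * P = (X - C w₁) * (X - C w₂) * E + σ * L * E
        + σ * Q * ((X - C w₁) * (X - C w₂) * E) := by
      linear_combination E * hHP + E * σ * hP
    rw [h3, h2, hudef]
    ring
  have hΦE : Φ = E * P * v := by
    linear_combination (E * P * v) * hΦ - Φ * hv - Φ * v * hkey
  rw [hΦE]
  refine ((hEb.mul hr.le hPA).mul hr.le hvb).mono (le_of_eq ?_)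
  ring

/-- Compactness gives room beyond the closed disc, so that the Taylor series of a reciprocal
converges absolutely up to its boundary. -/
lemma exists_ball_forall_ne_zero {f : ℂ → ℂ} (hf : Continuous f) {r : ℝ} (hr : 0 ≤ r)
    (h : ∀ x, ‖x‖ ≤ r → f x ≠ 0) : ∃ R > r, ∀ x ∈ Metric.ball (0 : ℂ) R, f x ≠ 0 := by
  obtain ⟨δ, hδ, hsub⟩ := (isCompact_closedBall (0 : ℂ) r).exists_thickening_subset_open
    (isOpen_ne_fun hf continuous_const : IsOpen {x | f x ≠ 0}) (fun x hx => h x (by simpa using hx))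
  rw [thickening_closedBall hδ hr] at hsub
  exact ⟨δ + r, by linarith, fun x hx => hsub hx⟩

lemma exists_eq_X_sub_mul_X_sub_mul {f : ℂ → ℂ} {U : Set ℂ} (hU : IsOpen U)
    (hf : DifferentiableOn ℂ f U) {w₁ w₂ : ℂ} (h₁ : w₁ ∈ U) (h₂ : w₂ ∈ U) (hw : w₁ ≠ w₂)
    (hf₁ : f w₁ = 0) (hf₂ : f w₂ = 0) :
    ∃ g : ℂ → ℂ, DifferentiableOn ℂ g U ∧ ∀ x, f x = (x - w₁) * ((x - w₂) * g x) := by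
  refine ⟨dslope (dslope f w₁) w₂, (Complex.differentiableOn_dslope (hU.mem_nhds h₂)).2
    ((Complex.differentiableOn_dslope (hU.mem_nhds h₁)).2 hf), fun x => ?_⟩
  have e₁ : ∀ x, (x - w₁) * dslope f w₁ x = f x := fun x => by
    simpa [hf₁] using sub_smul_dslope f w₁ x
  have e₂ : dslope f w₁ w₂ = 0 := by
    have := e₁ w₂
    rw [hf₂] at this
    exact (mul_eq_zero.1 this).resolve_left (sub_ne_zero.2 hw.symm)
  have e₃ : (x - w₂) * dslope (dslope f w₁) w₂ x = dslope f w₁ x := by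
    simpa [e₂] using sub_smul_dslope (dslope f w₁) w₂ x
  rw [e₃, e₁]

lemma deriv_mul_sub_of_eq {f g : ℂ → ℂ} {w₁ w₂ : ℂ} (hg : DifferentiableAt ℂ g w₁)
    (h : ∀ x, f x = (x - w₁) * ((x - w₂) * g x)) : deriv f w₁ = (w₁ - w₂) * g w₁ := by
  have h1 : HasDerivAt (fun x => (x - w₁) * ((x - w₂) * g x)) _ w₁ :=
    ((hasDerivAt_id w₁).sub_const w₁).mul
      (((hasDerivAt_id w₁).sub_const w₂).mul hg.hasDerivAt)
  rw [show f = _ from funext h, h1.deriv]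
  simp

lemma taylorPS_sub_const (c : ℂ) : taylorPS (fun x => x - c) = X - C c := by
  have h := taylorPS_add (f := fun x => x) (g := fun _ => -c) analyticAt_id analyticAt_const
  rw [taylorPS_id, taylorPS_const] at h
  simpa [sub_eq_add_neg] using h

lemma taylorPS_mul_of_differentiableOn {f g : ℂ → ℂ} {R : ℝ} (hR : 0 < R)
    (hf : DifferentiableOn ℂ f (Metric.ball 0 R)) (hg : DifferentiableOn ℂ g (Metric.ball 0 R)) :
    taylorPS (fun x => f x * g x) = taylorPS f * taylorPS g :=
  taylorPS_mul (hf.analyticAt (Metric.ball_mem_nhds 0 hR)) (hg.analyticAt (Metric.ball_mem_nhds 0 hR))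

lemma taylorPS_add_of_differentiableOn {f g : ℂ → ℂ} {R : ℝ} (hR : 0 < R)
    (hf : DifferentiableOn ℂ f (Metric.ball 0 R)) (hg : DifferentiableOn ℂ g (Metric.ball 0 R)) :
    taylorPS (fun x => f x + g x) = taylorPS f + taylorPS g :=
  taylorPS_add (hf.analyticAt (Metric.ball_mem_nhds 0 hR)) (hg.analyticAt (Metric.ball_mem_nhds 0 hR))

lemma taylorPS_sub_mul_sub_mul {g : ℂ → ℂ} {R : ℝ} (hR : 0 < R)
    (hg : DifferentiableOn ℂ g (Metric.ball 0 R)) (w₁ w₂ : ℂ) :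
    taylorPS (fun x => (x - w₁) * ((x - w₂) * g x)) = (X - C w₁) * ((X - C w₂) * taylorPS g) := by
  rw [taylorPS_mul_of_differentiableOn (g := fun x => (x - w₂) * g x) hR (by fun_prop)
      (DifferentiableOn.mul (by fun_prop) hg),
    taylorPS_mul_of_differentiableOn hR (by fun_prop) hg, taylorPS_sub_const, taylorPS_sub_const]

lemma exists_wienerBound_taylorPS_resolvent {h : ℂ → ℂ} (hh : Differentiable ℂ h) {r : ℝ}
    (hr : 0 ≤ r) {s : ℂ} (hz : ∀ x, ‖x‖ ≤ r → s + h x ≠ 0) :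
    ∃ Φ A, (C s + taylorPS h) * Φ = 1 ∧ WienerBound r Φ A := by
  obtain ⟨R, hR, hne⟩ := exists_ball_forall_ne_zero (f := fun x => s + h x)
    (continuous_const.add hh.continuous) hr hz
  have hd : DifferentiableOn ℂ (fun x => (s + h x)⁻¹) (Metric.ball 0 R) :=
    DifferentiableOn.inv (by fun_prop) hne
  obtain ⟨A, hA⟩ := exists_wienerBound_taylorPS hr hR hd
  refine ⟨_, A, ?_, hA⟩
  have hR0 : 0 < R := hr.trans_lt hR
  rw [← taylorPS_const, ← taylorPS_add_of_differentiableOn hR0 (by fun_prop) (by fun_prop),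
    ← taylorPS_mul_of_differentiableOn hR0 (by fun_prop) hd, ← map_one C, ← taylorPS_const]
  refine taylorPS_congr ?_
  filter_upwards [Metric.ball_mem_nhds 0 hR0] with x hx
  exact mul_inv_cancel₀ (hne x hx)

/-- The resolvent estimate `‖(s + h)⁻¹‖ = O(1 / s)` in the Wiener norm of radius `r`. -/
lemma exists_wienerBound_resolvent {h : ℂ → ℂ} (hh : Differentiable ℂ h) {r : ℝ} (hr : 0 < r)
    {w₁ w₂ : ℂ} (hw₁ : ‖w₁‖ = r) (hw₂ : ‖w₂‖ = r) (hw : w₁ ≠ w₂) (h₁ : h w₁ = 0) (h₂ : h w₂ = 0)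
    (ha₁ : 0 < (-(deriv h w₁)⁻¹ * (starRingEnd ℂ) w₁).re)
    (ha₂ : 0 < (-(deriv h w₂)⁻¹ * (starRingEnd ℂ) w₂).re)
    (hz : ∀ s : ℝ, 0 ≤ s → ∀ x : ℂ, ‖x‖ ≤ r → s + h x = 0 → s = 0 ∧ (x = w₁ ∨ x = w₂)) :
    ∃ K : ℝ, ∀ s : ℝ, 0 < s → ∀ Φ : ℂ⟦X⟧, (C (s : ℂ) + taylorPS h) * Φ = 1 →
      WienerBound r Φ (K / s) := by
  have hd₁ : deriv h w₁ ≠ 0 := by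
    intro h0
    simp [h0] at ha₁
  have hd₂ : deriv h w₂ ≠ 0 := by
    intro h0
    simp [h0] at ha₂
  set a₁ := -(deriv h w₁)⁻¹ with ha₁'
  set a₂ := -(deriv h w₂)⁻¹ with ha₂'
  obtain ⟨q, hq, hhq⟩ := exists_eq_X_sub_mul_X_sub_mul isOpen_univ hh.differentiableOn
    (Set.mem_univ w₁) (Set.mem_univ w₂) hw h₁ h₂
  rw [differentiableOn_univ] at hq
  have hdq₁ := deriv_mul_sub_of_eq (hq w₁) hhq
  have hdq₂ := deriv_mul_sub_of_eq (hq w₂) (fun x => (hhq x).trans (mul_left_comm _ _ _))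
  have hq0 : ∀ x, ‖x‖ ≤ r → q x ≠ 0 := by
    intro x hx h0
    have hhx : h x = 0 := by rw [hhq, h0]; ring
    rcases (hz 0 le_rfl x hx (by simp [hhx])).2 with rfl | rfl
    · exact hd₁ (by rw [hdq₁, h0, mul_zero])
    · exact hd₂ (by rw [hdq₂, h0, mul_zero])
  obtain ⟨R, hR, hne⟩ := exists_ball_forall_ne_zero hq.continuous hr.le hq0
  have hR0 : 0 < R := hr.trans hR
  have hp : DifferentiableOn ℂ (fun x => (q x)⁻¹) (Metric.ball 0 R) :=
    DifferentiableOn.inv hq.differentiableOn hne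
  have hm₁ : w₁ ∈ Metric.ball (0 : ℂ) R := by simpa [hw₁] using hR
  have hm₂ : w₂ ∈ Metric.ball (0 : ℂ) R := by simpa [hw₂] using hR
  -- Since `h' (w₁) = (w₁ - w₂) q(w₁)`, and symmetrically at `w₂`, the linear polynomial subtracted
  -- from `1 / q` interpolates it at both points. The remainder is therefore divisible by `(x -
  -- w₁)(x - w₂)`.
  obtain ⟨p₂, hp₂, hpp₂⟩ := exists_eq_X_sub_mul_X_sub_mul
    (f := fun x => (q x)⁻¹ + (a₁ * (x - w₂) + a₂ * (x - w₁))) Metric.isOpen_ball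
    (hp.add (by fun_prop)) hm₁ hm₂ hw
    (by
      have := hne _ hm₁
      have := sub_ne_zero.2 hw
      simp only [ha₁', hdq₁]
      field_simp
      ring)
    (by
      have := hne _ hm₂
      have := sub_ne_zero.2 hw.symm
      simp only [ha₂', hdq₂]
      field_simp
      ring)
  obtain ⟨A, hA⟩ := exists_wienerBound_taylorPS hr.le hR hp
  obtain ⟨B, hB⟩ := exists_wienerBound_taylorPS hr.le hR hp₂
  obtain ⟨N, hN⟩ := exists_wienerBound_taylorPS hr.le hR (hh.differentiableOn (s := Metric.ball 0 R))
  have hHP : taylorPS h * taylorPS (fun x => (q x)⁻¹) = (X - C w₁) * (X - C w₂) := by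
    rw [← taylorPS_mul_of_differentiableOn hR0 hh.differentiableOn hp]
    have h1 := taylorPS_sub_mul_sub_mul (g := fun _ => 1) hR0 (by fun_prop) w₁ w₂
    rw [taylorPS_const, map_one, mul_one] at h1
    rw [← h1]
    refine taylorPS_congr ?_
    filter_upwards [Metric.ball_mem_nhds 0 hR0] with x hx
    have := hne x hx
    rw [hhq]
    field_simp
  have hP : taylorPS (fun x => (q x)⁻¹) = -(C a₁ * (X - C w₂)) - C a₂ * (X - C w₁)
      + (X - C w₁) * (X - C w₂) * taylorPS p₂ := by
    have h1 := taylorPS_sub_mul_sub_mul hR0 hp₂ w₁ w₂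
    rw [← funext hpp₂, taylorPS_add_of_differentiableOn hR0 hp (by fun_prop),
      taylorPS_add_of_differentiableOn hR0 (by fun_prop) (by fun_prop),
      taylorPS_mul_of_differentiableOn hR0 (by fun_prop) (by fun_prop),
      taylorPS_mul_of_differentiableOn hR0 (by fun_prop) (by fun_prop),
      taylorPS_sub_const, taylorPS_sub_const, taylorPS_const, taylorPS_const] at h1
    linear_combination h1
  obtain ⟨ε, hε, K, hK⟩ := exists_wienerBound_resolvent_small hr hw₁ hw₂ hw ha₁ ha₂ hHP hP hA hB
  -- On a compact range of `s` away from `0` the resolvent exists at each point and is perturbed by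
  -- a Neumann series nearby, so finitely many local bounds suffice.
  have hmid : ∃ D : ℝ, ∀ s ∈ Set.Icc ε (2 * N), ∀ Φ : ℂ⟦X⟧, (C (s : ℂ) + taylorPS h) * Φ = 1 →
      WienerBound r Φ D := by
    refine (isCompact_Icc (a := ε) (b := 2 * N)).induction_on (p := fun S => ∃ D : ℝ, ∀ s ∈ S, ∀ Φ : ℂ⟦X⟧,
      (C (s : ℂ) + taylorPS h) * Φ = 1 → WienerBound r Φ D) ⟨0, by simp⟩ ?_ ?_ ?_
    · rintro S T hST ⟨D, hD⟩
      exact ⟨D, fun s hs => hD s (hST hs)⟩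
    · rintro S T ⟨D, hD⟩ ⟨D', hD'⟩
      refine ⟨max D D', fun s hs Φ hΦ => ?_⟩
      rcases hs with hs | hs
      · exact (hD s hs Φ hΦ).mono (le_max_left _ _)
      · exact (hD' s hs Φ hΦ).mono (le_max_right _ _)
    · intro s₀ hs₀
      have hs₀0 : 0 < s₀ := hε.trans_le hs₀.1
      obtain ⟨Φ₀, D, hΦ₀, hD⟩ := exists_wienerBound_taylorPS_resolvent hh hr.le (s := (s₀ : ℂ))
        (fun x hx h0 => hs₀0.ne' (hz s₀ hs₀0.le x hx h0).1)
      have hD0 := hD.nonneg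
      refine ⟨Metric.ball s₀ (1 / (2 * (D + 1))),
        mem_nhdsWithin_of_mem_nhds (Metric.ball_mem_nhds _ (by positivity)), 2 * D,
        fun s hs Φ hΦ => ?_⟩
      have hs' : |s₀ - s| * D ≤ 1 / 2 := by
        rw [Metric.mem_ball, dist_comm, Real.dist_eq, lt_div_iff₀ (by positivity)] at hs
        nlinarith [abs_nonneg (s₀ - s)]
      have hu : WienerBound r (C ((s₀ - s : ℝ) : ℂ) * Φ₀) (1 / 2) :=
        (hD.const_mul hr.le _).mono (by simpa [-Complex.ofReal_sub] using hs')
      obtain ⟨v, hv, hvb⟩ := hu.exists_inv_one_sub hr.le (by norm_num)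
      have e : Φ = Φ₀ * v := by
        rw [Complex.ofReal_sub, map_sub] at hv
        linear_combination (Φ₀ * v) * hΦ - Φ * hv - Φ * v * hΦ₀
      rw [e]
      exact (hD.mul hr.le hvb).mono (le_of_eq (by ring))
  obtain ⟨D, hD⟩ := hmid
  refine ⟨max K (max (D * (2 * N)) 2), fun s hs Φ hΦ => ?_⟩
  rcases le_or_gt s ε with hsε | hsε
  · exact (hK s hs hsε Φ hΦ).mono (by gcongr; exact le_max_left _ _)
  rcases le_or_gt s (2 * N) with hsN | hsN
  · have hDs := hD s ⟨hsε.le, hsN⟩ Φ hΦ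
    refine hDs.mono ?_
    rw [le_div_iff₀ hs]
    exact (mul_le_mul_of_nonneg_left hsN hDs.nonneg).trans
      ((le_max_left _ _).trans (le_max_right _ _))
  -- For `s > 2N` the series `h / s` has norm at most `1/2`, and a direct Neumann series applies.
  · have hu : WienerBound r (C ((-s⁻¹ : ℝ) : ℂ) * taylorPS h) (1 / 2) := by
      refine (hN.const_mul hr.le _).mono ?_
      rw [Complex.norm_real, norm_neg, Real.norm_of_nonneg (by positivity), inv_mul_le_iff₀ hs]
      linarith
    obtain ⟨v, hv, hvb⟩ := hu.exists_inv_one_sub hr.le (by norm_num)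
    have hC : (C (s : ℂ) : ℂ⟦X⟧) * C ((s⁻¹ : ℝ) : ℂ) = 1 := by
      rw [← map_mul, ← Complex.ofReal_mul, mul_inv_cancel₀ hs.ne']
      simp
    have e : Φ = C ((s⁻¹ : ℝ) : ℂ) * v := by
      rw [Complex.ofReal_neg, map_neg] at hv
      linear_combination (C ((s⁻¹ : ℝ) : ℂ) * v) * hΦ - Φ * hv - Φ * v * hC
    rw [e]
    refine (hvb.const_mul hr.le _).mono ?_
    rw [Complex.norm_real, Real.norm_of_nonneg (by positivity), div_eq_inv_mul _ s]
    gcongr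
    exact le_trans (by norm_num) ((le_max_right _ _).trans (le_max_right _ _))

/-! ### Location and motion of the zeros of `s + x + e^(-x)` -/

/-- Strict concavity of the sine makes `sin x / x` decreasing. -/
lemma mul_sin_lt_mul_sin {x y : ℝ} (hx : 0 < x) (hxy : x < y) (hy : y ≤ Real.pi) :
    x * Real.sin y < y * Real.sin x := by
  have hy0 := hx.trans hxy
  have h := strictConcaveOn_sin_Icc.2
    (show (0 : ℝ) ∈ Set.Icc 0 Real.pi from ⟨le_rfl, Real.pi_pos.le⟩)
    (show y ∈ Set.Icc 0 Real.pi from ⟨hy0.le, hy⟩) hy0.ne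
    (show 0 < 1 - x / y by rw [sub_pos, div_lt_one hy0]; exact hxy) (show 0 < x / y by positivity)
    (by ring)
  have e : x / y * y = x := by field_simp
  simp only [smul_eq_mul, Real.sin_zero, mul_zero, zero_add, e] at h
  rw [div_mul_eq_mul_div, div_lt_iff₀ hy0] at h
  linarith

/-- This is the decrease of `x cot x`, obtained from that of `sin x / x` at the points `y - x` and
`y + x`. -/
lemma mul_cos_mul_sin_lt {x y : ℝ} (hx : 0 < x) (hxy : x < y) (hy : y ≤ Real.pi / 2) :
    y * Real.cos y * Real.sin x < x * Real.cos x * Real.sin y := by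
  have h := mul_sin_lt_mul_sin (x := y - x) (y := y + x) (by linarith) (by linarith) (by linarith)
  rw [Real.sin_add, Real.sin_sub] at h
  linarith

lemma bounds_of_exp_mul_cos_eq {a b : ℝ} (hb : 0 < b) (hbπ : b < Real.pi)
    (hc : Real.exp a * Real.cos b = a) (hs : Real.exp a * Real.sin b = b) :
    0 < a ∧ a < 1 ∧ b < Real.pi / 2 := by
  have hsin : 0 < Real.sin b := Real.sin_pos_of_pos_of_lt_pi hb hbπ
  have ha : 0 < a := by
    by_contra! h
    have h1 := Real.exp_le_one_iff.2 h
    have h2 := Real.sin_lt hb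
    nlinarith
  have hcos : 0 < Real.cos b := by
    rw [← hc] at ha
    exact (mul_pos_iff_of_pos_left (Real.exp_pos _)).1 ha
  have hb2 : b < Real.pi / 2 := by
    by_contra! h
    exact hcos.not_ge (Real.cos_nonpos_of_pi_div_two_le_of_le h (by linarith))
  refine ⟨ha, ?_, hb2⟩
  have h1 := Real.lt_tan hb hb2
  rw [Real.tan_eq_sin_div_cos, lt_div_iff₀ hcos] at h1
  have h2 : a * Real.sin b = b * Real.cos b := by
    linear_combination Real.cos b * hs - Real.sin b * hc
  nlinarith

/-- The equations read `e^a = b / sin b`, increasing in `b`, and `a - s = b cot b`, decreasing in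
`b`. If `b < b₀`, then `a < a₀` but `a - s > a₀`, impossible for `s ≥ 0`. If `b > b₀`, then `a > a₀
> 0` and the modulus is too large. -/
lemma eq_of_exp_mul_cos_eq_sub {a₀ b₀ a b s : ℝ} (hb₀ : 0 < b₀) (hb₀π : b₀ < Real.pi)
    (hc₀ : Real.exp a₀ * Real.cos b₀ = a₀) (hs₀ : Real.exp a₀ * Real.sin b₀ = b₀)
    (hb : 0 < b) (hs0 : 0 ≤ s) (hc : Real.exp a * Real.cos b = a - s)
    (hs : Real.exp a * Real.sin b = b) (hle : a ^ 2 + b ^ 2 ≤ a₀ ^ 2 + b₀ ^ 2) :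
    s = 0 ∧ a = a₀ ∧ b = b₀ := by
  obtain ⟨ha₀, ha₀1, hb₀2⟩ := bounds_of_exp_mul_cos_eq hb₀ hb₀π hc₀ hs₀
  have hbπ : b < Real.pi := by
    have := Real.pi_gt_three
    nlinarith
  have hsin : 0 < Real.sin b := Real.sin_pos_of_pos_of_lt_pi hb hbπ
  have hsin₀ : 0 < Real.sin b₀ := Real.sin_pos_of_pos_of_lt_pi hb₀ hb₀π
  rcases lt_trichotomy b b₀ with h | h | h
  · exfalso
    have h1 := mul_sin_lt_mul_sin hb h hb₀π.le
    have h2 : Real.exp a < Real.exp a₀ := by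
      have : 0 < (Real.exp a₀ - Real.exp a) * (Real.sin b * Real.sin b₀) := by
        have e : (Real.exp a₀ - Real.exp a) * (Real.sin b * Real.sin b₀)
          = b₀ * Real.sin b - b * Real.sin b₀ := by
          linear_combination Real.sin b * hs₀ - Real.sin b₀ * hs
        rw [e]
        linarith
      exact sub_pos.1 ((mul_pos_iff_of_pos_right (by positivity)).1 this)
    rw [Real.exp_lt_exp] at h2
    have h3 := mul_cos_mul_sin_lt hb h hb₀2.le
    have h4 : a₀ * Real.sin b₀ = b₀ * Real.cos b₀ := by
      linear_combination Real.cos b₀ * hs₀ - Real.sin b₀ * hc₀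
    have h5 : (a - s) * Real.sin b = b * Real.cos b := by
      linear_combination Real.cos b * hs - Real.sin b * hc
    have h6 : 0 < (a - s - a₀) * (Real.sin b * Real.sin b₀) := by
      have e : (a - s - a₀) * (Real.sin b * Real.sin b₀)
          = b * Real.cos b * Real.sin b₀ - b₀ * Real.cos b₀ * Real.sin b := by
        linear_combination Real.sin b₀ * h5 - Real.sin b * h4
      rw [e]
      linarith
    have h7 := (mul_pos_iff_of_pos_right (by positivity)).1 h6
    linarith
  · subst h
    have h1 : Real.exp a = Real.exp a₀ := mul_right_cancel₀ hsin.ne' (hs.trans hs₀.symm)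
    have h2 := Real.exp_injective h1
    subst h2
    exact ⟨by linarith, rfl, rfl⟩
  · exfalso
    have h1 := mul_sin_lt_mul_sin hb₀ h hbπ.le
    have h2 : 0 < (Real.exp a - Real.exp a₀) * (Real.sin b * Real.sin b₀) := by
      have e : (Real.exp a - Real.exp a₀) * (Real.sin b * Real.sin b₀)
          = b * Real.sin b₀ - b₀ * Real.sin b := by
        linear_combination Real.sin b₀ * hs - Real.sin b * hs₀
      rw [e]
      linarith
    have h3 := Real.exp_lt_exp.1 (sub_pos.1 ((mul_pos_iff_of_pos_right (by positivity)).1 h2))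
    nlinarith

lemma exp_neg_eq_neg_of_mul_exp_eq {w : ℂ} (h : w * Complex.exp w = -1) :
    Complex.exp (-w) = -w := by
  rw [Complex.exp_neg]
  have := Complex.exp_ne_zero w
  field_simp
  linear_combination h

/-- The real equations satisfied by a nonreal solution of `w e ^ w = -1`. -/
lemma exp_mul_cos_abs_im {w : ℂ} (h : w * Complex.exp w = -1) :
    Real.exp (-w.re) * Real.cos |w.im| = -w.re ∧
      Real.exp (-w.re) * Real.sin |w.im| = |w.im| := by
  have h1 := exp_neg_eq_neg_of_mul_exp_eq h
  have hre := congrArg Complex.re h1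
  have him := congrArg Complex.im h1
  rw [Complex.exp_re] at hre
  rw [Complex.exp_im] at him
  simp only [Complex.neg_re, Complex.neg_im, Real.cos_neg, Real.sin_neg] at hre him
  rw [Real.cos_abs]
  refine ⟨hre, ?_⟩
  rcases abs_cases w.im with ⟨e, _⟩ | ⟨e, _⟩ <;> rw [e]
  · linarith
  · rw [Real.sin_neg]
    exact him

lemma zero_of_add_exp_neg {w : ℂ} (hw : w * Complex.exp w = -1) (h0 : w.im ≠ 0)
    (hπ : |w.im| < Real.pi) {s : ℝ} (hs : 0 ≤ s) {x : ℂ} (hx : ‖x‖ ≤ ‖w‖)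
    (h : s + (x + Complex.exp (-x)) = 0) : s = 0 ∧ (x = w ∨ x = (starRingEnd ℂ) w) := by
  obtain ⟨hc₀, hs₀⟩ := exp_mul_cos_abs_im hw
  have hre := congrArg Complex.re h
  have him := congrArg Complex.im h
  simp only [Complex.add_re, Complex.add_im, Complex.exp_re, Complex.exp_im, Complex.neg_re,
    Complex.neg_im, Real.cos_neg, Real.sin_neg, Complex.ofReal_re, Complex.ofReal_im,
    Complex.zero_re, Complex.zero_im] at hre him
  have hb : 0 < |x.im| := by
    rw [abs_pos]
    intro hx0
    rw [hx0, Real.cos_zero] at hre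
    have := Real.add_one_le_exp (-x.re)
    linarith
  have hle : (-x.re) ^ 2 + |x.im| ^ 2 ≤ (-w.re) ^ 2 + |w.im| ^ 2 := by
    have h1 : ‖x‖ ^ 2 ≤ ‖w‖ ^ 2 := by gcongr
    rw [Complex.sq_norm, Complex.sq_norm, Complex.normSq_apply, Complex.normSq_apply] at h1
    rw [sq_abs, sq_abs]
    linarith
  have hc : Real.exp (-x.re) * Real.cos |x.im| = -x.re - s := by
    rw [Real.cos_abs]
    linarith
  have hsx : Real.exp (-x.re) * Real.sin |x.im| = |x.im| := by
    rcases abs_cases x.im with ⟨e, _⟩ | ⟨e, _⟩ <;> rw [e]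
    · linarith
    · rw [Real.sin_neg]
      linarith
  obtain ⟨h1, h2, h3⟩ := eq_of_exp_mul_cos_eq_sub (abs_pos.2 h0) hπ hc₀ hs₀ hb hs hc hsx hle
  refine ⟨h1, ?_⟩
  rw [neg_inj] at h2
  rcases abs_eq_abs.1 h3 with h4 | h4
  · exact Or.inl (Complex.ext h2 h4)
  · exact Or.inr (Complex.ext (by simpa using h2) (by simpa using h4))

lemma mul_exp_conj {w : ℂ} (hw : w * Complex.exp w = -1) :
    (starRingEnd ℂ) w * Complex.exp ((starRingEnd ℂ) w) = -1 := by
  rw [Complex.exp_conj, ← map_mul, hw, map_neg, map_one]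

lemma deriv_add_exp_neg {w : ℂ} (hw : w * Complex.exp w = -1) :
    deriv (fun x => x + Complex.exp (-x)) w = 1 + w := by
  have h : HasDerivAt (fun x : ℂ => x + Complex.exp (-x)) (1 + Complex.exp (-w) * -1) w :=
    (hasDerivAt_id w).add (hasDerivAt_neg w).cexp
  rw [h.deriv, exp_neg_eq_neg_of_mul_exp_eq hw]
  ring

/-- The zero of `s + h` near `w` has initial velocity `-1 / h'(w)`, and the claim is that it points
out of the disc. Up to a positive factor the quantity is `b² + a(1 - a)` with `a = -Re w` and `b =
Im w`, and `0 < a < 1`. -/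
lemma re_neg_inv_deriv_mul_conj_pos {w : ℂ} (hw : w * Complex.exp w = -1) (h0 : w.im ≠ 0)
    (hπ : |w.im| < Real.pi) :
    0 < (-(deriv (fun x => x + Complex.exp (-x)) w)⁻¹ * (starRingEnd ℂ) w).re := by
  obtain ⟨hc₀, hs₀⟩ := exp_mul_cos_abs_im hw
  obtain ⟨h1, h2, -⟩ := bounds_of_exp_mul_cos_eq (abs_pos.2 h0) hπ hc₀ hs₀
  rw [deriv_add_exp_neg hw]
  have hn : 0 < Complex.normSq (1 + w) := by
    rw [Complex.normSq_pos]
    intro h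
    have := congrArg Complex.im h
    simp at this
    exact h0 this
  have e : (-(1 + w)⁻¹ * (starRingEnd ℂ) w).re
      = (w.im ^ 2 - w.re - w.re ^ 2) / Complex.normSq (1 + w) := by
    simp only [Complex.mul_re, Complex.neg_re, Complex.neg_im, Complex.inv_re, Complex.inv_im,
      Complex.conj_re, Complex.conj_im, Complex.add_re, Complex.add_im, Complex.one_re,
      Complex.one_im]
    field_simp
    ring
  rw [e]
  refine div_pos ?_ hn
  have := sq_nonneg w.im
  nlinarith

/-! ### The values of the Lambert function at `-1` -/

/-- Eliminating `a` leaves `b cot b = log (b / sin b)`, solved by the intermediate value theorem on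
`[1, π/2]`. The sign at `1` follows from `log y ≤ y - 1` and `sin 1 + cos 1 ≥ 1`. -/
lemma exists_exp_mul_cos_eq : ∃ a b : ℝ, 0 < b ∧ b < Real.pi ∧
    Real.exp a * Real.cos b = a ∧ Real.exp a * Real.sin b = b := by
  have hπ3 := Real.pi_gt_three
  have hsin : ∀ b ∈ Set.Icc (1 : ℝ) (Real.pi / 2), 0 < Real.sin b := fun b hb =>
    Real.sin_pos_of_pos_of_lt_pi (by linarith [hb.1]) (by linarith [hb.2])
  have hcont : ContinuousOn (fun b : ℝ => b * Real.cos b / Real.sin b - Real.log (b / Real.sin b))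
      (Set.Icc 1 (Real.pi / 2)) := by
    refine ContinuousOn.sub (ContinuousOn.div (by fun_prop) (by fun_prop) fun b hb =>
      (hsin b hb).ne') (ContinuousOn.log (ContinuousOn.div (by fun_prop) (by fun_prop) fun b hb =>
      (hsin b hb).ne') fun b hb => ?_)
    exact (div_pos (by linarith [hb.1]) (hsin b hb)).ne'
  have hs1 : 0 < Real.sin 1 := hsin 1 ⟨le_rfl, by linarith⟩
  obtain ⟨b, hb, hb0⟩ := intermediate_value_Icc' (by linarith) hcont (show (0 : ℝ) ∈ _ from by
    constructor
    · rw [Real.cos_pi_div_two, Real.sin_pi_div_two]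
      have := Real.log_nonneg (x := Real.pi / 2) (by linarith)
      simpa using this
    · have h1 : Real.log (1 / Real.sin 1) ≤ 1 / Real.sin 1 - 1 :=
        Real.log_le_sub_one_of_pos (by positivity)
      have h2 : 1 ≤ Real.cos 1 + Real.sin 1 := by
        have hc := Real.cos_pos_of_mem_Ioo (x := 1) ⟨by linarith, by linarith⟩
        nlinarith [Real.sin_sq_add_cos_sq 1]
      have h3 : 1 / Real.sin 1 - 1 ≤ 1 * Real.cos 1 / Real.sin 1 := by
        rw [div_sub_one hs1.ne', one_mul]
        gcongr
        linarith
      linarith)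
  have hsb := hsin b hb
  have hb1 : 0 < b := by linarith [hb.1]
  have hexp : Real.exp (b * Real.cos b / Real.sin b) = b / Real.sin b := by
    rw [sub_eq_zero.1 hb0, Real.exp_log (by positivity)]
  refine ⟨b * Real.cos b / Real.sin b, b, hb1, by linarith [hb.2], ?_, ?_⟩ <;> rw [hexp]
  · ring
  · field_simp

lemma im_ne_zero_of_mul_exp_eq {w : ℂ} (h : w * Complex.exp w = -1) : w.im ≠ 0 := by
  intro h0
  have h1 := (exp_mul_cos_abs_im h).1
  rw [h0, abs_zero, Real.cos_zero, mul_one] at h1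
  have := Real.add_one_le_exp (-w.re)
  linarith

/-- Comparing arguments in `w e^w = -1` shows that `Im w + arg w` is an odd multiple of `π`. The
branch then selects which one. -/
lemma cos_im_add_arg_of_mul_exp_eq {w : ℂ} (h : w * Complex.exp w = -1) :
    Real.cos (w.im + w.arg) = -1 := by
  have h1 := exp_neg_eq_neg_of_mul_exp_eq h
  have hw : w ≠ 0 := by
    rintro rfl
    simp at h
  have hn : ‖w‖ = Real.exp (-w.re) := by
    rw [← norm_neg, ← h1, Complex.norm_exp, Complex.neg_re]
  have hre := congrArg Complex.re h1
  have him := congrArg Complex.im h1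
  rw [Complex.exp_re] at hre
  rw [Complex.exp_im] at him
  simp only [Complex.neg_re, Complex.neg_im, Real.cos_neg, Real.sin_neg] at hre him
  have hp := Real.exp_pos (-w.re)
  rw [Real.cos_add, Complex.cos_arg hw, Complex.sin_arg, hn, div_eq_mul_inv, div_eq_mul_inv]
  have e1 : w.re = -(Real.exp (-w.re) * Real.cos w.im) := by linarith
  have e2 : w.im = Real.exp (-w.re) * Real.sin w.im := by linarith
  have e3 : Real.cos w.im * w.re - Real.sin w.im * w.im = -Real.exp (-w.re) := by
    linear_combination Real.cos w.im * e1 - Real.sin w.im * e2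
      - Real.exp (-w.re) * Real.sin_sq_add_cos_sq w.im
  field_simp
  linarith

lemma exists_mem_lambertWRange : ∃ w : ℂ, w ∈ lambertWRange 0 ∧
    (starRingEnd ℂ) w ∈ lambertWRange (-1) ∧ w * Complex.exp w = -1 := by
  obtain ⟨a, b, hb, hbπ, hc, hs⟩ := exists_exp_mul_cos_eq
  have hw : (⟨-a, b⟩ : ℂ) = (Real.exp a : ℂ) *
      (Complex.cos ((Real.pi - b : ℝ) : ℂ) + Complex.sin ((Real.pi - b : ℝ) : ℂ) * Complex.I) := by
    rw [← Complex.ofReal_cos, ← Complex.ofReal_sin, Real.cos_pi_sub, Real.sin_pi_sub]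
    refine Complex.ext ?_ ?_ <;>
      simp only [Complex.add_re, Complex.add_im,
        Complex.ofReal_re, Complex.ofReal_im, Complex.mul_re, Complex.mul_im, Complex.I_re,
        Complex.I_im] <;> linarith
  have harg : (⟨-a, b⟩ : ℂ).arg = Real.pi - b := by
    rw [hw]
    exact Complex.arg_mul_cos_add_sin_mul_I (Real.exp_pos a) ⟨by linarith, by linarith⟩
  have hπ := Real.pi_pos
  refine ⟨⟨-a, b⟩, Or.inl ⟨?_, ?_, fun h => hb.ne' h.1⟩, Or.inl ⟨?_, ?_, fun h => ?_⟩, ?_⟩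
  · rw [harg]
    push_cast
    linarith
  · rw [harg]
    push_cast
    linarith
  · rw [Complex.arg_conj, harg, if_neg (by linarith)]
    simp only [Complex.conj_im]
    push_cast
    linarith
  · rw [Complex.arg_conj, harg, if_neg (by linarith)]
    simp only [Complex.conj_im]
    push_cast
    linarith
  · exact hb.ne' (by simpa using h.1)
  · have hcs := Real.sin_sq_add_cos_sq b
    have he : Real.exp (-a) * Real.exp a = 1 := by rw [← Real.exp_add]; simp
    refine Complex.ext ?_ ?_ <;>
      simp only [Complex.mul_re, Complex.mul_im, Complex.exp_re, Complex.exp_im, Complex.neg_re,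
        Complex.neg_im, Complex.one_re, Complex.one_im]
    · linear_combination Real.exp (-a) * Real.cos b * hc + Real.exp (-a) * Real.sin b * hs
        - Real.exp (-a) * Real.exp a * hcs - he
    · linear_combination Real.exp (-a) * Real.sin b * hc - Real.exp (-a) * Real.cos b * hs

/-- `W_0(-1)` and `W_{-1}(-1)` are nonreal solutions of `w e ^ w = -1` in the strip
`|Im w| < π`. -/
lemma lambertW_neg_one_spec {k : ℤ} (hk : k = 0 ∨ k = -1) :
    lambertW k (-1) * Complex.exp (lambertW k (-1)) = -1 ∧ (lambertW k (-1)).im ≠ 0 ∧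
      |(lambertW k (-1)).im| < Real.pi := by
  obtain ⟨w₀, h₀, h₁, hw₀⟩ := exists_mem_lambertWRange
  have hex : ∃ w : ℂ, w ∈ lambertWRange k ∧ w * Complex.exp w = -1 := by
    rcases hk with rfl | rfl
    · exact ⟨w₀, h₀, hw₀⟩
    · exact ⟨_, h₁, mul_exp_conj hw₀⟩
  have hdef : lambertW k (-1) = hex.choose := by
    unfold lambertW
    exact dif_pos hex
  obtain ⟨hmem, hw⟩ := hdef ▸ hex.choose_spec
  set w := lambertW k (-1)
  have h0 := im_ne_zero_of_mul_exp_eq hw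
  have hcos := cos_im_add_arg_of_mul_exp_eq hw
  refine ⟨hw, h0, ?_⟩
  have hπ := Real.pi_pos
  have harg := Complex.arg_le_pi w
  have harg' := Complex.neg_pi_lt_arg w
  rcases hmem with ⟨hl, hr, -⟩ | ⟨-, h, -⟩
  swap
  · exact absurd h h0
  rcases hk with rfl | rfl
  · push_cast at hl hr
    -- The window of branch `0` leaves only `Im w + arg w = π`; for branch `-1` below it is `-π`.
    have h1 := (Real.cos_eq_one_iff_of_lt_of_lt (x := w.im + w.arg - Real.pi)
      (by linarith) (by linarith)).1 (by rw [Real.cos_sub_pi, hcos, neg_neg])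
    have him : 0 < w.im := lt_of_le_of_ne (by linarith) h0.symm
    have hpos : 0 < w.arg := by
      refine lt_of_le_of_ne (Complex.arg_nonneg_iff.2 him.le) fun h => ?_
      exact h0 (Complex.arg_eq_zero_iff.1 h.symm).2
    rw [abs_of_pos him]
    linarith
  · push_cast at hl hr
    have h1 := (Real.cos_eq_one_iff_of_lt_of_lt (x := w.im + w.arg + Real.pi)
      (by linarith) (by linarith)).1 (by rw [Real.cos_add_pi, hcos, neg_neg])
    have him : w.im < 0 := by linarith
    have hneg : w.arg < 0 := Complex.arg_neg_iff.2 him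
    rw [abs_of_neg him]
    linarith

/-! ### Generating function of the associated Stirling numbers -/

/-- The number of partitions of the finite set `s` into `k` blocks of size at least `m`. -/
def partitionCount {α : Type*} [DecidableEq α] (m : ℕ) (s : Finset α) (k : ℕ) : ℕ :=
  (Finset.univ.filter fun P : Finpartition s => P.parts.card = k ∧ ∀ b ∈ P.parts, m ≤ b.card).card

lemma sup_erase_part {α : Type*} [DecidableEq α] {a : α} {s : Finset α} (ha : a ∉ s)
    (P : Finpartition (insert a s)) :
    (P.parts.erase (P.part a)).sup id = s \ (P.part a).erase a := by
  have hpa : P.part a ∈ P.parts := P.part_mem.2 (Finset.mem_insert_self a s)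
  have haa : a ∈ P.part a := P.mem_part_self.2 (Finset.mem_insert_self a s)
  ext x
  simp only [Finset.mem_sup, Finset.mem_erase, Finset.mem_sdiff, id]
  constructor
  · rintro ⟨b, ⟨hb, hbP⟩, hx⟩
    have hxa : x ∉ P.part a := fun h => hb (P.eq_of_mem_parts hbP hpa hx h)
    have hne : x ≠ a := by
      rintro rfl
      exact hxa haa
    exact ⟨(Finset.mem_insert.1 (P.subset hbP hx)).resolve_left hne, fun h => hxa h.2⟩
  · rintro ⟨hx, hx'⟩
    have hne : x ≠ a := by
      rintro rfl
      exact ha hx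
    obtain ⟨b, hb, hxb⟩ := P.exists_mem (Finset.mem_insert_of_mem hx)
    exact ⟨b, ⟨fun h => hx' ⟨hne, h ▸ hxb⟩, hb⟩, hxb⟩

/-- Splitting off the block that contains a given element. -/
lemma partitionCount_insert {α : Type*} [DecidableEq α] (m k : ℕ) {a : α} {s : Finset α}
    (ha : a ∉ s) :
    partitionCount m (insert a s) (k + 1) =
      ∑ t ∈ s.powerset, if m ≤ t.card + 1 then partitionCount m (s \ t) k else 0 := by
  rw [← Finset.sum_filter]
  unfold partitionCount
  rw [← Finset.card_sigma]
  symm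
  have hsub : ∀ x ∈ (s.powerset.filter fun t => m ≤ t.card + 1).sigma fun t =>
      (Finset.univ.filter fun P : Finpartition (s \ t) =>
        P.parts.card = k ∧ ∀ b ∈ P.parts, m ≤ b.card), x.1 ⊆ s := by
    intro x hx
    rw [Finset.mem_sigma, Finset.mem_filter, Finset.mem_powerset] at hx
    exact hx.1.1
  have hnot : ∀ {t : Finset α} (Q : Finpartition (s \ t)), ∀ b ∈ Q.parts, a ∉ b :=
    fun Q b hb hab => ha (Finset.mem_sdiff.1 (Q.subset hb hab)).1
  -- A pair of a subset `t` and a partition of `s \ t` corresponds to the partition that gains the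
  -- block `insert a t`; the inverse removes the block of `a`.
  refine Finset.card_bij (fun x hx => x.2.extend (b := insert a x.1) (c := insert a s)
    (Finset.insert_ne_empty _ _) ?_ ?_) ?_ ?_ ?_
  · rw [Finset.disjoint_insert_right]
    exact ⟨fun h => ha (Finset.mem_sdiff.1 h).1, Finset.sdiff_disjoint⟩
  · rw [Finset.sup_eq_union, Finset.union_insert, Finset.sdiff_union_of_subset (hsub x hx)]
  · rintro ⟨t, Q⟩ hx
    simp only [Finset.mem_sigma, Finset.mem_filter, Finset.mem_powerset, Finset.mem_univ,
      true_and] at hx ⊢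
    refine ⟨by rw [Finpartition.card_extend, hx.2.1], fun b hb => ?_⟩
    rw [Finpartition.extend, Finset.mem_insert] at hb
    rcases hb with rfl | hb
    · rw [Finset.card_insert_of_notMem fun h => ha (hx.1.1 h)]
      exact hx.1.2
    · exact hx.2.2 b hb
  · rintro ⟨t, Q⟩ hx ⟨t', Q'⟩ hx' h
    have hat : a ∉ t := fun h => ha (hsub _ hx h)
    have hat' : a ∉ t' := fun h => ha (hsub _ hx' h)
    have hp : insert (insert a t) Q.parts = insert (insert a t') Q'.parts :=
      congrArg Finpartition.parts h
    have htt : insert a t = insert a t' := by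
      have h1 : insert a t ∈ insert (insert a t') Q'.parts := hp ▸ Finset.mem_insert_self _ _
      exact (Finset.mem_insert.1 h1).resolve_right
        fun h2 => hnot Q' _ h2 (Finset.mem_insert_self _ _)
    have ht : t = t' := by
      rw [← Finset.erase_insert hat, htt, Finset.erase_insert hat']
    subst ht
    have hQ : Q = Q' := by
      refine Finpartition.ext ?_
      rw [← Finset.erase_insert fun h2 => hnot Q _ h2 (Finset.mem_insert_self a t), hp,
        Finset.erase_insert fun h2 => hnot Q' _ h2 (Finset.mem_insert_self a t)]
    rw [hQ]
  · intro P hP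
    rw [Finset.mem_filter] at hP
    have hpa : P.part a ∈ P.parts := P.part_mem.2 (Finset.mem_insert_self a s)
    have haa : a ∈ P.part a := P.mem_part_self.2 (Finset.mem_insert_self a s)
    refine ⟨⟨(P.part a).erase a, P.ofSubset (Finset.erase_subset (P.part a) P.parts)
      (sup_erase_part ha P)⟩, ?_, ?_⟩
    · simp only [Finset.mem_sigma, Finset.mem_filter, Finset.mem_powerset, Finset.mem_univ,
        true_and]
      refine ⟨⟨?_, ?_⟩, ?_, fun b hb => hP.2.2 b (Finset.mem_of_mem_erase hb)⟩
      · exact Finset.subset_insert_iff.1 (P.part_subset a)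
      · rw [Finset.card_erase_add_one haa]
        exact hP.2.2 _ hpa
      · have := Finset.card_erase_of_mem hpa
        simp only [Finpartition.ofSubset]
        omega
    · refine Finpartition.ext ?_
      simp only [Finpartition.extend, Finpartition.ofSubset]
      rw [Finset.insert_erase haa, Finset.insert_erase hpa]

lemma partitionCount_zero {α : Type*} [DecidableEq α] (m : ℕ) (s : Finset α) :
    partitionCount m s 0 = if s.card = 0 then 1 else 0 := by
  unfold partitionCount
  split_ifs with h
  · rw [Finset.card_eq_zero] at h
    subst h
    rw [Finset.card_eq_one]
    refine ⟨⊥, Finset.eq_singleton_iff_unique_mem.2 ⟨by simp, fun P hP => ?_⟩⟩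
    rw [Finset.mem_filter, Finset.card_eq_zero] at hP
    exact Finpartition.ext (by simp [hP.2.1])
  · rw [Finset.card_eq_zero, Finset.filter_eq_empty_iff]
    rintro P - ⟨h0, -⟩
    rw [Finset.card_eq_zero, Finpartition.parts_eq_empty_iff] at h0
    exact h (by simpa using h0)

lemma partitionCount_empty_succ {α : Type*} [DecidableEq α] (m k : ℕ) :
    partitionCount m (∅ : Finset α) (k + 1) = 0 := by
  unfold partitionCount
  rw [Finset.card_eq_zero, Finset.filter_eq_empty_iff]
  rintro P - ⟨h0, -⟩
  have := P.card_parts_le_card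
  rw [Finset.card_empty] at this
  omega

/-- Differentiating `(e^x - 1 - x)^(k+1)` gives `(k+1)(e^x - 1)(e^x - 1 - x)^k`, the analytic
counterpart of splitting off the block of a marked element. That block has `j ≥ 1` further elements.
-/
lemma coeff_succ_exp_sub_pow (n k : ℕ) :
    ((n : ℂ) + 1) * coeff (n + 1) ((exp ℂ - 1 - X) ^ (k + 1)) =
      (k + 1) * ∑ j ∈ Finset.range (n + 1),
        (if 2 ≤ j + 1 then (1 : ℂ) / j.factorial else 0) * coeff (n - j) ((exp ℂ - 1 - X) ^ k) := by
  have hd : derivative ℂ (exp ℂ - 1 - X) = exp ℂ - 1 := by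
    rw [map_sub, map_sub, derivative_exp, derivative_X]
    simp
  have h := congrArg (coeff n) ((derivative ℂ).leibniz_pow (exp ℂ - 1 - X) (k + 1))
  rw [hd, coeff_derivative, Nat.add_sub_cancel, nsmul_eq_mul, smul_eq_mul] at h
  rw [mul_comm, h, mul_comm ((exp ℂ - 1 - X) ^ k), ← map_natCast (C (R := ℂ)), coeff_C_mul, coeff_mul,
    Finset.Nat.sum_antidiagonal_eq_sum_range_succ_mk]
  push_cast
  congr 1
  refine Finset.sum_congr rfl fun j _ => ?_
  congr 1
  rcases j with _ | j
  · simp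
  · simp [coeff_exp, coeff_one]

/-- The exponential generating function of the associated Stirling numbers with blocks of size at
least two. -/
lemma partitionCount_two {α : Type*} [DecidableEq α] (s : Finset α) (k : ℕ) :
    (partitionCount 2 s k : ℂ) =
      s.card.factorial / k.factorial * coeff s.card ((exp ℂ - 1 - X) ^ k) := by
  induction hn : s.card using Nat.strong_induction_on generalizing s k with
  | _ N ih =>
  rcases k with _ | k
  · rw [partitionCount_zero, hn, pow_zero, coeff_one]
    split_ifs with h <;> simp [h]
  rcases s.eq_empty_or_nonempty with rfl | ⟨a, ha⟩
  · rw [partitionCount_empty_succ, ← hn, Finset.card_empty, coeff_zero_eq_constantCoeff_apply]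
    simp
  obtain ⟨s, has, rfl⟩ : ∃ t, a ∉ t ∧ insert a t = s :=
    ⟨s.erase a, Finset.notMem_erase a s, Finset.insert_erase ha⟩
  rw [Finset.card_insert_of_notMem has] at hn
  subst hn
  rw [partitionCount_insert 2 k has, Nat.cast_sum]
  simp only [Nat.cast_ite, Nat.cast_zero]
  rw [Finset.sum_congr rfl (g := fun t : Finset α => if 2 ≤ t.card + 1 then
    ((s.card - t.card).factorial : ℂ) / k.factorial *
      coeff (s.card - t.card) ((exp ℂ - 1 - X) ^ k) else 0)]
  swap
  · intro t ht
    rw [Finset.mem_powerset] at ht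
    split_ifs
    · exact ih _ (by omega) _ _ (Finset.card_sdiff_of_subset ht)
    · rfl
  rw [Finset.sum_powerset_apply_card (fun j => if 2 ≤ j + 1 then
    ((s.card - j).factorial : ℂ) / k.factorial *
      coeff (s.card - j) ((exp ℂ - 1 - X) ^ k) else 0)]
  have h := coeff_succ_exp_sub_pow s.card k
  have hk : (k.factorial : ℂ) ≠ 0 := by exact_mod_cast k.factorial_ne_zero
  have hk1 : (k : ℂ) + 1 ≠ 0 := by exact_mod_cast k.succ_ne_zero
  rw [Nat.factorial_succ, Nat.factorial_succ]
  simp only [Nat.cast_mul, Nat.cast_add, Nat.cast_one]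
  have e : ((s.card : ℂ) + 1) * s.card.factorial / ((k + 1) * k.factorial) *
      coeff (s.card + 1) ((exp ℂ - 1 - X) ^ (k + 1)) = s.card.factorial / k.factorial *
      ∑ j ∈ Finset.range (s.card + 1),
        (if 2 ≤ j + 1 then (1 : ℂ) / j.factorial else 0) *
          coeff (s.card - j) ((exp ℂ - 1 - X) ^ k) := by
    field_simp
    linear_combination (s.card.factorial : ℂ) * h
  rw [e, Finset.mul_sum]
  refine Finset.sum_congr rfl fun j hj => ?_
  rw [nsmul_eq_mul, Nat.cast_choose ℂ (Finset.mem_range_succ_iff.1 hj)]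
  have hj0 : (j.factorial : ℂ) ≠ 0 := by exact_mod_cast j.factorial_ne_zero
  have hj1 : ((s.card - j).factorial : ℂ) ≠ 0 := by
    exact_mod_cast (s.card - j).factorial_ne_zero
  split_ifs
  · field_simp
  · simp

lemma associatedStirlingSecond_two (n k : ℕ) :
    (associatedStirlingSecond 2 n k : ℂ) =
      n.factorial / k.factorial * coeff n ((exp ℂ - 1 - X) ^ k) := by
  have h := partitionCount_two (Finset.univ : Finset (Fin n)) k
  rw [Finset.card_univ, Fintype.card_fin] at h
  rw [← h]
  unfold associatedStirlingSecond partitionCount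
  congr!

/-! ### Poly-Bernoulli numbers as combinations of power series coefficients -/

lemma taylorPS_add_exp_neg :
    taylorPS (fun x => x + Complex.exp (-x)) = 1 + rescale (-1) (exp ℂ - 1 - X) := by
  rw [taylorPS_add (f := fun x => x) analyticAt_id (by fun_prop), taylorPS_id]
  have h : taylorPS (fun x => Complex.exp (-x)) = rescale (-1) (exp ℂ) := by
    ext n
    have h1 := iteratedDeriv_cexp_const_mul n (-1)
    simp only [neg_one_mul] at h1
    simp [taylorPS, h1, coeff_rescale, coeff_exp, div_eq_mul_inv]
  rw [h, map_sub, map_sub, rescale_X, map_one]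
  simp
  ring

/-- Geometric series for `1 / (z - G)`: as `X` divides `G`, the terms beyond `G^n` do not reach the
coefficient of order `n`. -/
lemma coeff_eq_sum_of_sub_mul_eq_one {G Φ : ℂ⟦X⟧} (hG : constantCoeff G = 0) {z : ℂ} (hz : z ≠ 0)
    (h : (C z - G) * Φ = 1) (n : ℕ) :
    coeff n Φ = ∑ k ∈ Finset.range (n + 1), z⁻¹ ^ (k + 1) * coeff n (G ^ k) := by
  have hC : (C z : ℂ⟦X⟧) * C z⁻¹ = 1 := by rw [← map_mul, mul_inv_cancel₀ hz, map_one]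
  have hgeom := mul_neg_geom_sum (C z⁻¹ * G) (n + 1)
  set S := ∑ k ∈ Finset.range (n + 1), (C z⁻¹ * G) ^ k with hS
  have h1 : Φ = C z⁻¹ * S + G ^ (n + 1) * (Φ * C z⁻¹ ^ (n + 1)) := by
    rw [mul_pow] at hgeom
    linear_combination C z⁻¹ * S * h - Φ * hgeom - Φ * S * hC
  have h2 : coeff n (G ^ (n + 1) * (Φ * C z⁻¹ ^ (n + 1))) = 0 :=
    X_pow_dvd_iff.1 ((pow_dvd_pow_of_dvd (X_dvd_iff.2 hG) (n + 1)).mul_right _) n n.lt_succ_self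
  rw [h1, map_add, h2, add_zero, coeff_C_mul, hS, map_sum, Finset.mul_sum]
  refine Finset.sum_congr rfl fun k _ => ?_
  rw [mul_pow, ← map_pow, coeff_C_mul, pow_succ]
  ring

/-- The numbers `B_{n, ≥ 2} / n!` in terms of the coefficients of the powers of
`1 - x - e ^ (-x)`. -/
lemma associatedPolyBernoulli_two_div_factorial (μ : ℂ) (n : ℕ) :
    associatedPolyBernoulli 2 μ n / n.factorial = ∑ k ∈ Finset.range (n + 1),
      (1 / ((k : ℂ) + 1)) ^ μ * coeff n ((-rescale (-1) (exp ℂ - 1 - X)) ^ k) := by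
  unfold associatedPolyBernoulli
  rw [Finset.sum_div]
  refine Finset.sum_congr rfl fun k hk => ?_
  have hkn : k ≤ n := Finset.mem_range_succ_iff.1 hk
  have hk0 : (k.factorial : ℂ) ≠ 0 := by exact_mod_cast k.factorial_ne_zero
  have hn0 : (n.factorial : ℂ) ≠ 0 := by exact_mod_cast n.factorial_ne_zero
  have harg : ((k : ℂ) + 1).arg ≠ Real.pi := by
    rw [← Nat.cast_succ, Complex.natCast_arg]
    exact Real.pi_pos.ne
  have hp : ((k : ℂ) + 1) ^ μ ≠ 0 := by
    rw [Ne, Complex.cpow_eq_zero_iff]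
    exact fun h => Nat.cast_add_one_ne_zero k h.1
  have hsign : (-1 : ℂ) ^ (n - k) = (-1) ^ k * (-1) ^ n := by
    obtain ⟨j, rfl⟩ := Nat.exists_eq_add_of_le hkn
    rw [Nat.add_sub_cancel_left, pow_add, ← mul_assoc, ← mul_pow]
    simp
  have hc : coeff n ((-rescale (-1) (exp ℂ - 1 - X)) ^ k) =
      (-1) ^ k * ((-1) ^ n * coeff n ((exp ℂ - 1 - X) ^ k)) := by
    rw [neg_pow, ← map_pow, ← coeff_rescale]
    rw [show ((-1 : ℂ⟦X⟧) ^ k) = C ((-1) ^ k) by simp, coeff_C_mul]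
  rw [associatedStirlingSecond_two, hsign, hc, one_div, Complex.inv_cpow _ _ harg]
  field_simp

/-! ### Mellin integrals and the exchange of sum and integral -/

/-- A nonintegrable function has Bochner integral `0` by convention, so the nonzero Gamma value
forces integrability. -/
lemma integrableOn_cpow_mul_exp {μ : ℂ} (hμ : 0 < μ.re) {p : ℝ} (hp : 0 < p) :
    MeasureTheory.IntegrableOn (fun t : ℝ => (t : ℂ) ^ (μ - 1) * Complex.exp (-(p * t)))
      (Set.Ioi 0) := by
  refine MeasureTheory.Integrable.of_integral_ne_zero ?_
  rw [Complex.integral_cpow_mul_exp_neg_mul_Ioi hμ hp]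
  refine mul_ne_zero ?_ (Complex.Gamma_ne_zero_of_re_pos hμ)
  rw [Ne, Complex.cpow_eq_zero_iff]
  exact fun h => one_div_ne_zero (Complex.ofReal_ne_zero.2 hp.ne') h.1

lemma integrableOn_rpow_mul_exp {a p : ℝ} (ha : 0 < a) (hp : 0 < p) :
    MeasureTheory.IntegrableOn (fun t : ℝ => t ^ (a - 1) * Real.exp (-(p * t))) (Set.Ioi 0) := by
  refine MeasureTheory.Integrable.of_integral_ne_zero ?_
  rw [Real.integral_rpow_mul_exp_neg_mul_Ioi ha hp]
  exact (mul_pos (Real.rpow_pos_of_pos (by positivity) _) (Real.Gamma_pos_of_pos ha)).ne'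

/-- This is `t / 2 ≤ sinh (t / 2)`. It turns `K / (e^t - 1)` into a Gamma-type majorant, controlling
both ends of the half-line. -/
lemma mul_exp_half_le_exp_sub_one {t : ℝ} (ht : 0 ≤ t) :
    t * Real.exp (1 / 2 * t) ≤ Real.exp t - 1 := by
  have h := Real.self_le_sinh_iff.2 (by linarith : 0 ≤ 1 / 2 * t)
  rw [Real.sinh_eq] at h
  have h1 : Real.exp (1 / 2 * t) * Real.exp (-(1 / 2 * t)) = 1 := by
    rw [← Real.exp_add]
    simp
  have h2 : Real.exp (1 / 2 * t) * Real.exp (1 / 2 * t) = Real.exp t := by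
    rw [← Real.exp_add]
    ring_nf
  nlinarith [Real.exp_pos (1 / 2 * t)]

/-- Mellin transform of `1 / (e ^ t - 1)`. -/
lemma integral_cpow_div_exp_sub_one {μ : ℂ} (hμ : 1 < μ.re) :
    ∫ t : ℝ in Set.Ioi 0, (t : ℂ) ^ (μ - 1) * (1 / ((Real.exp t - 1 : ℝ) : ℂ)) =
      Complex.Gamma μ * riemannZeta μ := by
  have h := hasSum_mellin (a := fun _ : ℕ => 1) (p := fun i => (i : ℝ) + 1)
    (F := fun t => 1 / ((Real.exp t - 1 : ℝ) : ℂ)) (s := μ) (fun i => Or.inr (by positivity))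
    (by linarith) (fun t ht => ?_) ?_
  · rw [zeta_eq_tsum_one_div_nat_add_one_cpow hμ, ← tsum_mul_left]
    refine h.tsum_eq.symm.trans (tsum_congr fun n => ?_)
    push_cast
    ring
  · have ht : (0 : ℝ) < t := ht
    have h1 : Real.exp (-t) < 1 := Real.exp_lt_one_iff.2 (by linarith)
    have h2 := (hasSum_geometric_of_lt_one (Real.exp_pos (-t)).le h1).mul_left (Real.exp (-t))
    have h3 : Real.exp (-t) * (1 - Real.exp (-t))⁻¹ = 1 / (Real.exp t - 1) := by
      have h4 : 1 < Real.exp t := Real.one_lt_exp_iff.2 ht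
      have h5 : Real.exp t - 1 ≠ 0 := by linarith
      rw [Real.exp_neg]
      field_simp
    rw [h3] at h2
    have h6 := Complex.hasSum_ofReal.2 h2
    convert! h6 using 2
    · rw [one_mul, ← Real.exp_nat_mul, ← Real.exp_add]
      ring_nf
    · push_cast
      rfl
  · have h1 := (summable_nat_add_iff 1).2 (Real.summable_one_div_nat_rpow.2 hμ)
    simpa using h1

/-- The series converges to `ζ(μ)` at every nonreal solution of `w e ^ w = -1` with
`|Im w| < π`. -/
lemma hasSum_associatedPolyBernoulli_two {μ : ℂ} (hμ : 1 < μ.re) {w : ℂ}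
    (hw : w * Complex.exp w = -1) (h0 : w.im ≠ 0) (hπ : |w.im| < Real.pi) :
    HasSum (fun n : ℕ => associatedPolyBernoulli 2 μ n * w ^ n / (n.factorial : ℂ))
      (riemannZeta μ) := by
  set h : ℂ → ℂ := fun x => x + Complex.exp (-x) with hdef
  set G : ℂ⟦X⟧ := -rescale (-1) (exp ℂ - 1 - X) with hG
  have hHG : taylorPS h = 1 - G := by
    rw [hdef, taylorPS_add_exp_neg, hG]
    ring
  have hG0 : constantCoeff G = 0 := by
    rw [hG, map_neg, ← coeff_zero_eq_constantCoeff_apply, coeff_rescale]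
    simp
  have hh : Differentiable ℂ h := by fun_prop
  have hwn : w ≠ 0 := by
    rintro rfl
    simp at h0
  have hr : 0 < ‖w‖ := norm_pos_iff.2 hwn
  have hhw : h w = 0 := by
    rw [hdef]
    simp only [exp_neg_eq_neg_of_mul_exp_eq hw]
    ring
  have hw' := mul_exp_conj hw
  have h0' : ((starRingEnd ℂ) w).im ≠ 0 := by simpa using h0
  have hπ' : |((starRingEnd ℂ) w).im| < Real.pi := by simpa using hπ
  have hhw' : h ((starRingEnd ℂ) w) = 0 := by
    rw [hdef]
    simp only [exp_neg_eq_neg_of_mul_exp_eq hw']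
    ring
  have hne : w ≠ (starRingEnd ℂ) w := by
    intro he
    exact h0 (Complex.conj_eq_iff_im.1 he.symm)
  obtain ⟨K, hK⟩ := exists_wienerBound_resolvent hh hr rfl (Complex.norm_conj w) hne hhw hhw'
    (re_neg_inv_deriv_mul_conj_pos hw h0 hπ) (re_neg_inv_deriv_mul_conj_pos hw' h0' hπ')
    (fun s hs x hx => zero_of_add_exp_neg hw h0 hπ hs hx)
  set Φ : ℝ → ℂ⟦X⟧ := fun t => (C ((Real.exp t - 1 : ℝ) : ℂ) + taylorPS h)⁻¹ with hΦdef
  have hΦ : ∀ t, (C ((Real.exp t - 1 : ℝ) : ℂ) + taylorPS h) * Φ t = 1 := by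
    intro t
    refine PowerSeries.mul_inv_cancel _ ?_
    rw [hHG, map_add, map_sub, hG0, constantCoeff_C]
    simp
  have hs : ∀ t > 0, 0 < Real.exp t - 1 := fun t ht => by
    have := Real.one_lt_exp_iff.2 ht
    linarith
  have hcoeff : ∀ t n, coeff n (Φ t) = ∑ k ∈ Finset.range (n + 1),
      Complex.exp (-(((k : ℝ) + 1 : ℝ) * t)) * coeff n (G ^ k) := by
    intro t n
    rw [coeff_eq_sum_of_sub_mul_eq_one hG0 (Complex.exp_ne_zero t) (Φ := Φ t)]
    · refine Finset.sum_congr rfl fun k _ => ?_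
      rw [← Complex.exp_neg, ← Complex.exp_nat_mul]
      push_cast
      ring_nf
    · rw [← hΦ t, hHG]
      push_cast
      rw [map_sub, map_one]
      ring
  have hF : ∀ n, (fun t : ℝ => (t : ℂ) ^ (μ - 1) * (coeff n (Φ t) * w ^ n)) =
      fun t : ℝ => ∑ k ∈ Finset.range (n + 1), (coeff n (G ^ k) * w ^ n) *
        ((t : ℂ) ^ (μ - 1) * Complex.exp (-(((k : ℝ) + 1 : ℝ) * t))) := by
    intro n
    funext t
    rw [hcoeff, Finset.sum_mul, Finset.mul_sum]
    exact Finset.sum_congr rfl fun k _ => by ring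
  have hint : ∀ n (k : ℕ), MeasureTheory.Integrable (fun t : ℝ => (coeff n (G ^ k) * w ^ n) *
        ((t : ℂ) ^ (μ - 1) * Complex.exp (-(((k : ℝ) + 1 : ℝ) * t))))
        (MeasureTheory.volume.restrict (Set.Ioi 0)) := fun n k =>
    (integrableOn_cpow_mul_exp (by linarith) (by positivity)).const_mul _
  have hFint : ∀ n, MeasureTheory.Integrable
      (fun t : ℝ => (t : ℂ) ^ (μ - 1) * (coeff n (Φ t) * w ^ n))
      (MeasureTheory.volume.restrict (Set.Ioi 0)) := by
    intro n
    rw [hF]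
    exact MeasureTheory.integrable_finsetSum _ fun k _ => hint n k
  have hval : ∀ n, ∫ t : ℝ in Set.Ioi 0, (t : ℂ) ^ (μ - 1) * (coeff n (Φ t) * w ^ n) =
      Complex.Gamma μ * (associatedPolyBernoulli 2 μ n * w ^ n / (n.factorial : ℂ)) := by
    intro n
    rw [hF, MeasureTheory.integral_finsetSum _ fun k _ => hint n k, mul_div_right_comm,
      associatedPolyBernoulli_two_div_factorial, Finset.sum_mul, Finset.mul_sum]
    refine Finset.sum_congr rfl fun k _ => ?_
    rw [MeasureTheory.integral_const_mul,
      Complex.integral_cpow_mul_exp_neg_mul_Ioi (by linarith) (by positivity)]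
    push_cast
    ring
  have hK0 : 0 ≤ K := by simpa using (hK 1 one_pos _ (PowerSeries.mul_inv_cancel _ (by
    rw [hHG, map_add, map_sub, hG0, constantCoeff_C]; norm_num))).nonneg
  -- The resolvent bound, uniform in the truncation `M`, dominates every partial sum by one
  -- integrable function with exponent `Re μ - 2 > -1`.
  have hsum : Summable fun n =>
      ∫ t : ℝ in Set.Ioi 0, ‖(t : ℂ) ^ (μ - 1) * (coeff n (Φ t) * w ^ n)‖ := by
    refine summable_of_sum_range_le
      (c := ∫ t : ℝ in Set.Ioi 0, K * (t ^ (μ.re - 1 - 1) * Real.exp (-(1 / 2 * t))))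
      (fun n => MeasureTheory.integral_nonneg fun t => norm_nonneg _) fun M => ?_
    rw [← MeasureTheory.integral_finsetSum _ fun n _ => (hFint n).norm]
    refine MeasureTheory.setIntegral_mono_on
      (MeasureTheory.integrable_finsetSum _ fun n _ => (hFint n).norm)
      ((integrableOn_rpow_mul_exp (by linarith) (by norm_num)).const_mul _)
      measurableSet_Ioi fun t ht => ?_
    have ht : (0 : ℝ) < t := ht
    have hb := hK _ (hs t ht) _ (hΦ t) M
    have e1 : ∑ n ∈ Finset.range M, ‖(t : ℂ) ^ (μ - 1) * (coeff n (Φ t) * w ^ n)‖ =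
        t ^ (μ.re - 1) * wienerSum ‖w‖ M (Φ t) := by
      rw [wienerSum, Finset.mul_sum]
      refine Finset.sum_congr rfl fun n _ => ?_
      rw [norm_mul, norm_mul, norm_pow, Complex.norm_cpow_eq_rpow_re_of_pos ht]
      simp
    rw [e1]
    have e2 : K / (Real.exp t - 1) ≤ K * (t⁻¹ * Real.exp (-(1 / 2 * t))) := by
      rw [Real.exp_neg, ← mul_inv, ← div_eq_mul_inv]
      gcongr
      exact mul_exp_half_le_exp_sub_one ht.le
    calc _ ≤ t ^ (μ.re - 1) * (K * (t⁻¹ * Real.exp (-(1 / 2 * t)))) := by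
          gcongr
          exact hb.trans e2
      _ = K * (t ^ (μ.re - 1 - 1) * Real.exp (-(1 / 2 * t))) := by
          rw [Real.rpow_sub_one ht.ne' (μ.re - 1)]
          ring
  have hmain := MeasureTheory.hasSum_integral_of_summable_integral_norm hFint hsum
  have htsum : ∫ t : ℝ in Set.Ioi 0, ∑' n, (t : ℂ) ^ (μ - 1) * (coeff n (Φ t) * w ^ n) =
      Complex.Gamma μ * riemannZeta μ := by
    rw [← integral_cpow_div_exp_sub_one hμ]
    refine MeasureTheory.setIntegral_congr_fun measurableSet_Ioi fun t ht => ?_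
    have ht : (0 : ℝ) < t := ht
    simp only [tsum_mul_left]
    congr 1
    set s := Real.exp t - 1 with hsdef
    have hs0 : (s : ℂ) ≠ 0 := Complex.ofReal_ne_zero.2 (hs t ht).ne'
    have hd : Differentiable ℂ (fun x => (s : ℂ) + h x) := hh.const_add _
    have hT : C (s : ℂ) + taylorPS h = taylorPS (fun x => (s : ℂ) + h x) := by
      rw [← taylorPS_const, taylorPS_add analyticAt_const (hh.analyticAt 0)]
    obtain ⟨A, hA⟩ := exists_wienerBound_taylorPS hr.le (lt_add_one ‖w‖)
      (hd.differentiableOn (s := Metric.ball 0 (‖w‖ + 1)))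
    -- Evaluate `(s + h) Φ_t = 1` at `w`, on the boundary circle, where both series converge
    -- absolutely. Since `h(w) = 0`, the value of `Φ_t` there is `1 / s`.
    have h1 := hA.tsum_mul (hK s (hs t ht) _ (hΦ t)) le_rfl
    rw [tsum_taylorPS hd.differentiableOn (lt_add_one ‖w‖), hhw, add_zero, ← hT, hΦ t] at h1
    rw [tsum_eq_single 0 (fun n hn => by simp [coeff_one, hn])] at h1
    rw [eq_div_iff hs0, mul_comm, ← h1]
    simp
  rw [htsum] at hmain
  simp only [hval] at hmain
  exact (hasSum_mul_left_iff (Complex.Gamma_ne_zero_of_re_pos (by linarith))).1 hmain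

theorem mainTheorem3 (μ : ℂ) (hμ : 1 < μ.re) (k : ℤ) (hk : k = 0 ∨ k = -1) :
    HasSum (fun n : ℕ => associatedPolyBernoulli 2 μ n * lambertW k (-1) ^ n / (n.factorial : ℂ))
      (riemannZeta μ) := by
  obtain ⟨hw, h0, hπ⟩ := lambertW_neg_one_spec hk
  exact hasSum_associatedPolyBernoulli_two hμ hw h0 hπ
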